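/- Conventions. Theories are first-order; a theory is identified with the set of (Gödel numbers of) its theorems, and it is RE, decidable, or of Turing degree $\mathbf{d}$ if this set is. $W_e$ is the RE set with index $e$. A pair $(B,C)$ of disjoint RE sets of natural numbers is recursively inseparable (RI) if there is no recursive set $X$ with $B\subseteq X$ and $X\cap C=\emptyset$. A consistent RE theory $T$ is RI if the pair (sentences provable in $T$, sentences refutable in $T$) is RI. It is Turing persistent if it is undecidable and $T\leq_T S$ for every consistent RE extension $S$ of $T$ (in the language of $T$ or in a larger one). Janiczak's theory $\mathsf{J}$ has one binary relation symbol $E$ and the axioms: $E$ is an equivalence relation; for every $n$ there is at most one equivalence class of size precisely $n$; for every $n$ there are at least $n$ equivalence classes with at least $n$ elements. $A_n$ is the sentence saying that there is an equivalence class of size precisely $n+1$. $\mathbf{R}$ is the theory of Tarski, Mostowski and Robinson with the axioms, for all $m,n\in\mathbb{N}$: $\overline m+\overline n=\overline{m+n}$; $\overline m\cdot\overline n=\overline{m\cdot n}$; $\overline m\neq\overline n$ if $m\neq n$; $\forall x(x\leq\overline n\to x=\overline 0\vee\dots\vee x=\overline n)$; $\forall x(x\leq\overline n\vee\overline n\leq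 x)$, where $x\leq y$ abbreviates $\exists z\,(z+x=y)$. Interpretations are relative, of any finite dimension, need not translate identity as identity, and may use parameters. Theorem. For every non-recursive RE Turing degree $\mathbf{d}$ one can effectively find a consistent RE theory $T_{\mathbf{d}}$ which is RI and Turing persistent, has Turing degree exactly $\mathbf{d}$, and does not interpret $\mathbf{R}$. More precisely, there are total recursive functions $b,c,t$ such that for every non-recursive RE degree $\mathbf{d}$ and every index $e$ with $W_e$ of degree $\mathbf{d}$, writing $A=W_e$, $B=W_{b(e)}$, $C=W_{c(e)}$: (1) $(B,C)$ is an RI pair, $B\leq_T A$, $C\leq_T A$, and $A\leq_T D$ for every RE set $D$ with $B\subseteq D$ and $D\cap C=\emptyset$; (2) the theory $T_{\mathbf{d}}=\mathsf{J}+\{A_n:n\in B\}+\{\neg A_n:n\in C\}$ is consistent and RE, and $W_{t(e)}$ is the set of Gödel numbers of its theorems; (3) $T_{\mathbf{d}}$ is RI; (4) $T_{\mathbf{d}}$ is Turing persistent; (5) $T_{\mathbf{d}}$ has Turing degree $\mathbf{d}$; (6) $T_{\mathbf{d}}$ does not interpret $\mathbf{R}$. -/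

import Mathlib

open FirstOrder FirstOrder.Language

namespace TuringPersistence

/-! ### Recursion theory on sets of natural numbers -/

/-- The recursively enumerable set with index `e`: the domain of the `e`-th partial recursive
function. -/
def reSet (e : Nat.Partrec.Code) : Set ℕ :=
  {n | (e.eval n).Dom}

/-- `A` is recursively enumerable. -/
def IsRE (A : Set ℕ) : Prop :=
  REPred fun n => n ∈ A

/-- `A` is recursive. -/
def IsRecursive (A : Set ℕ) : Prop :=
  ComputablePred fun n => n ∈ A

open Classical in
/-- The characteristic function of `A`, as an oracle. -/
noncomputable def charFun (A : Set ℕ) : ℕ →. ℕ :=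
  fun n => Part.some (if n ∈ A then 1 else 0)

/-- Turing reducibility of sets of natural numbers. -/
def TuringLE (A B : Set ℕ) : Prop :=
  TuringReducible (charFun A) (charFun B)

/-- The Turing degree of a set of natural numbers. -/
noncomputable def degree (A : Set ℕ) : TuringDegree :=
  toAntisymmetrization TuringReducible (charFun A)

/-- `X` separates `A` from `B`. -/
def Separates (X A B : Set ℕ) : Prop :=
  A ⊆ X ∧ Disjoint X B

/-- `(A, B)` is a recursively inseparable pair: a disjoint pair of recursively enumerable sets that
no recursive set separates. -/
def IsRIPair (A B : Set ℕ) : Prop :=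
  IsRE A ∧ IsRE B ∧ Disjoint A B ∧ ¬ ∃ X, IsRecursive X ∧ Separates X A B

/-! ### Gödel numbers -/

section Numbering

variable {L : FirstOrder.Language.{0, 0}} [Encodable (Σ n, L.Functions n)]

/-- The Gödel number of a term whose variables are `x_0, …, x_{n-1}`. -/
def termNumber {n : ℕ} : L.Term (Empty ⊕ Fin n) → ℕ
  | .var (.inl x) => x.elim
  | .var (.inr i) => Nat.pair 0 i
  | .func (l := l) f ts =>
      Nat.pair 1 (Nat.pair (Encodable.encode (⟨l, f⟩ : Σ n, L.Functions n))
        (Encodable.encode (List.ofFn fun i => termNumber (ts i))))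

theorem termNumber_injective {n : ℕ} :
    Function.Injective (termNumber : L.Term (Empty ⊕ Fin n) → ℕ) := by
  intro t
  induction t with
  | var x =>
    intro s h
    rcases x with x | i
    · exact x.elim
    · cases s with
      | var y =>
        rcases y with y | j
        · exact y.elim
        · simp only [termNumber, Nat.pair_eq_pair, true_and] at h
          rw [Fin.ext h]
      | func f ts => simp [termNumber, Nat.pair_eq_pair] at h
  | func f ts ih =>
    intro s h
    cases s with
    | var y =>
      rcases y with y | j
      · exact y.elim
      · simp [termNumber, Nat.pair_eq_pair] at h
    | func g us =>
      simp only [termNumber, Nat.pair_eq_pair, true_and, Encodable.encode_inj] at h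
      obtain ⟨h₁, h₂⟩ := h
      cases h₁
      have h₃ := List.ofFn_injective h₂
      have h₄ : ts = us := funext fun i => ih i (congrFun h₃ i)
      rw [h₄]

variable [Encodable (Σ n, L.Relations n)]

/-- The Gödel number of a formula whose free variables are `x_0, …, x_{n-1}`. -/
def formulaNumber : {n : ℕ} → L.BoundedFormula Empty n → ℕ
  | _, .falsum => Nat.pair 0 0
  | _, .equal t₁ t₂ => Nat.pair 1 (Nat.pair (termNumber t₁) (termNumber t₂))
  | _, .rel (l := l) R ts =>
      Nat.pair 2 (Nat.pair (Encodable.encode (⟨l, R⟩ : Σ n, L.Relations n))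
        (Encodable.encode (List.ofFn fun i => termNumber (ts i))))
  | _, .imp φ ψ => Nat.pair 3 (Nat.pair (formulaNumber φ) (formulaNumber ψ))
  | _, .all φ => Nat.pair 4 (formulaNumber φ)

/-- The Gödel number of a sentence. -/
def sentenceNumber (φ : L.Sentence) : ℕ :=
  formulaNumber φ

theorem formulaNumber_injective {n : ℕ} :
    Function.Injective (formulaNumber : L.BoundedFormula Empty n → ℕ) := by
  intro φ
  induction φ with
  | falsum =>
    intro ψ h
    cases ψ <;> simp [formulaNumber, Nat.pair_eq_pair] at h ⊢
  | equal t₁ t₂ =>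
    intro ψ h
    cases ψ <;> simp [formulaNumber, Nat.pair_eq_pair] at h ⊢
    exact ⟨termNumber_injective h.1, termNumber_injective h.2⟩
  | rel R ts =>
    intro ψ h
    cases ψ with
    | rel S us =>
      simp only [formulaNumber, Nat.pair_eq_pair, true_and, Encodable.encode_inj] at h
      obtain ⟨h₁, h₂⟩ := h
      cases h₁
      have h₃ := List.ofFn_injective h₂
      have h₄ : ts = us := funext fun i => termNumber_injective (congrFun h₃ i)
      rw [h₄]
    | _ => simp [formulaNumber, Nat.pair_eq_pair] at h
  | imp φ₁ φ₂ ih₁ ih₂ =>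
    intro ψ h
    cases ψ <;> simp [formulaNumber, Nat.pair_eq_pair] at h ⊢
    exact ⟨ih₁ h.1, ih₂ h.2⟩
  | all φ ih =>
    intro ψ h
    cases ψ <;> simp [formulaNumber, Nat.pair_eq_pair] at h ⊢
    exact ih h

/-- Distinct sentences have distinct Gödel numbers. -/
theorem sentenceNumber_injective :
    Function.Injective (sentenceNumber : L.Sentence → ℕ) :=
  formulaNumber_injective

/-! ### Metamathematical properties of theories

A theory is identified with the set of its theorems; `T ⊨ᵇ φ` says that the sentence `φ` is a
theorem of `T`. -/

/-- The Gödel numbers of the theorems of `T`. -/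
def provable (T : L.Theory) : Set ℕ :=
  {n | ∃ φ : L.Sentence, T ⊨ᵇ φ ∧ sentenceNumber φ = n}

/-- The Gödel numbers of the sentences that are refutable in `T`. -/
def refutable (T : L.Theory) : Set ℕ :=
  {n | ∃ φ : L.Sentence, T ⊨ᵇ (Formula.not φ) ∧ sentenceNumber φ = n}

/-- `T` is a consistent recursively enumerable theory. -/
def IsConsistentRE (T : L.Theory) : Prop :=
  T.IsSatisfiable ∧ IsRE (provable T)

/-- `T` is recursively inseparable: its theorems and its refutable sentences form a recursively
inseparable pair. -/
def IsRecInseparable (T : L.Theory) : Prop :=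
  IsConsistentRE T ∧ IsRIPair (provable T) (refutable T)

/-- `T` is Turing persistent: it is undecidable, and it is Turing reducible to every consistent
recursively enumerable extension `S`, in the same language or in a larger one. The larger language
is given with a numbering of its symbols and an inclusion `ι` that is computable on Gödel
numbers. -/
def IsTuringPersistent (T : L.Theory) : Prop :=
  IsConsistentRE T ∧ ¬ IsRecursive (provable T) ∧
    ∀ (L' : FirstOrder.Language.{0, 0})
      [Encodable (Σ n, L'.Functions n)] [Encodable (Σ n, L'.Relations n)]
      (ι : L →ᴸ L') (S : L'.Theory),
      ι.Injective →
      (∃ f : ℕ → ℕ, Computable f ∧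
        ∀ φ : L.Sentence, f (sentenceNumber φ) = sentenceNumber (ι.onSentence φ)) →
      IsConsistentRE S →
      (∀ φ : L.Sentence, T ⊨ᵇ φ → S ⊨ᵇ ι.onSentence φ) →
      TuringLE (provable T) (provable S)

end Numbering

/-! ### Interpretations -/

/-- The data of a translation of `L` into `L'`: a dimension `dim`, a number `params` of parameters
with a formula `paramDom` that restricts them, a formula `dom` for the domain, and a formula for
identity, for the graph of every function symbol (the value is the last block of variables) and for
every relation symbol. A variable of `L` becomes a block of `dim` variables of `L'`. -/
structure Translation (L L' : FirstOrder.Language.{0, 0}) where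
  dim : ℕ
  params : ℕ
  paramDom : L'.Formula (Fin params)
  dom : L'.Formula (Fin params ⊕ Fin dim)
  eq : L'.Formula (Fin params ⊕ Fin 2 × Fin dim)
  func : (n : ℕ) → L.Functions n → L'.Formula (Fin params ⊕ Fin (n + 1) × Fin dim)
  rel : (n : ℕ) → L.Relations n → L'.Formula (Fin params ⊕ Fin n × Fin dim)

namespace Translation

variable {L L' : FirstOrder.Language.{0, 0}} (τ : Translation L L')

/-- Formulas of `L'` in the parameters and in one block of variables for every `v : V`. -/
abbrev BlockFormula (V : Type) : Type :=
  L'.Formula (Fin τ.params ⊕ V × Fin τ.dim)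

/-- For formulas `g i` that say ‘the value of the `i`-th term is the block `none`’: there are blocks
`z_0, …, z_{k-1}` in the domain such that `z_i` is the value of the `i`-th term and `ψ` holds, where
`ψ` mentions `z_i` as the block `Sum.inr i`. -/
noncomputable def existsValues {V : Type} {k : ℕ} (g : Fin k → τ.BlockFormula (Option V))
    (ψ : τ.BlockFormula (V ⊕ Fin k)) : τ.BlockFormula V :=
  Formula.iExs (Fin k × Fin τ.dim) <|
    Formula.relabel
      (Sum.elim (fun p => .inl (.inl p))
        fun x => Sum.elim (fun v => .inl (.inr (v, x.2))) (fun i => .inr (i, x.2)) x.1)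
      (Formula.iInf (fun i : Fin k =>
          τ.dom.relabel (Sum.map id fun j => ((Sum.inr i : V ⊕ Fin k), j)) ⊓
          (g i).relabel (Sum.map id (Prod.map (fun v => v.elim (Sum.inr i) Sum.inl) id)))
        ⊓ ψ)

/-- The translation of ‘the value of the term `t` is `y`’, where `y` is the block `none`. -/
noncomputable def valueIs {V : Type} : L.Term V → τ.BlockFormula (Option V)
  | .var v => τ.eq.relabel (Sum.map id (Prod.map ![some v, none] id))
  | .func (l := l) f ts =>
      τ.existsValues
        (fun i => (valueIs (ts i)).relabel (Sum.map id (Prod.map (Option.map some) id)))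
        ((τ.func l f).relabel
          (Sum.map id (Prod.map (Fin.lastCases (Sum.inl none) Sum.inr) id)))

/-- The translation of a formula of `L`. Quantifiers are relativized to the domain. -/
noncomputable def formula : {n : ℕ} → L.BoundedFormula Empty n → τ.BlockFormula (Empty ⊕ Fin n)
  | _, .falsum => ⊥
  | _, .equal t₁ t₂ =>
      τ.existsValues ![τ.valueIs t₁, τ.valueIs t₂]
        (τ.eq.relabel (Sum.map id (Prod.map Sum.inr id)))
  | _, .rel (l := l) R ts =>
      τ.existsValues (fun i => τ.valueIs (ts i))
        ((τ.rel l R).relabel (Sum.map id (Prod.map Sum.inr id)))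
  | _, .imp φ ψ => (formula φ).imp (formula ψ)
  | n, .all φ =>
      Formula.iAlls (Fin τ.dim) <|
        (τ.dom.relabel (Sum.elim (fun p => .inl (.inl p)) Sum.inr)).imp
          ((formula φ).relabel
            (Sum.elim (fun p => .inl (.inl p)) fun x =>
              Sum.elim Empty.elim
                (Fin.lastCases (motive := fun _ =>
                    (Fin τ.params ⊕ (Empty ⊕ Fin n) × Fin τ.dim) ⊕ Fin τ.dim)
                  (.inr x.2) (fun i => .inl (.inr (.inr i, x.2)))) x.1))

/-- ‘For all admissible parameters, the translation of `φ` holds.’ -/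
noncomputable def sentence (φ : L.Sentence) : L'.Sentence :=
  Formula.iAlls (Fin τ.params) <|
    (τ.paramDom.imp ((τ.formula (n := 0) φ).relabel
      (Sum.elim id fun x => Sum.elim Empty.elim Fin.elim0 x.1))).relabel Sum.inr

/-- ‘There are admissible parameters.’ -/
noncomputable def paramsExist : L'.Sentence :=
  Formula.iExs (Fin τ.params) (τ.paramDom.relabel Sum.inr)

end Translation

/-- `T` interprets `U`: some translation (of any finite dimension, relativized to a domain, with
identity not necessarily translated as identity, and with parameters) maps all theorems of `U`,
those of pure logic with identity included, to theorems of `T`. -/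
def Interprets {L L' : FirstOrder.Language.{0, 0}} (T : L'.Theory) (U : L.Theory) : Prop :=
  ∃ τ : Translation L L', T ⊨ᵇ τ.paramsExist ∧ ∀ φ : L.Sentence, U ⊨ᵇ φ → T ⊨ᵇ τ.sentence φ

/-! ### The theory R -/

/-- The function symbols of arithmetic. -/
inductive ArithFunc : ℕ → Type
  | zero : ArithFunc 0
  | succ : ArithFunc 1
  | add : ArithFunc 2
  | mul : ArithFunc 2

/-- The language with `0`, `S`, `+` and `·`. -/
def arith : FirstOrder.Language.{0, 0} :=
  ⟨ArithFunc, fun _ => Empty⟩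

/-- The term `s + t`. -/
def addTerm {α : Type} (s t : arith.Term α) : arith.Term α :=
  Term.func (L := arith) ArithFunc.add ![s, t]

/-- The term `s · t`. -/
def mulTerm {α : Type} (s t : arith.Term α) : arith.Term α :=
  Term.func (L := arith) ArithFunc.mul ![s, t]

/-- The numeral of `n`. -/
def numeral {α : Type} : ℕ → arith.Term α
  | 0 => Term.func (L := arith) ArithFunc.zero ![]
  | n + 1 => Term.func (L := arith) ArithFunc.succ ![numeral n]

/-- The formula `s ≤ t`, which abbreviates `∃ z, z + s = t`. -/
def leFormula {n : ℕ} (s t : arith.Term (Empty ⊕ Fin n)) : arith.BoundedFormula Empty n :=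
  ((addTerm (.var (.inr (Fin.last n))) (s.relabel (Sum.map id Fin.castSucc))).bdEqual
    (t.relabel (Sum.map id Fin.castSucc))).ex

/-- The conjunction of a list of formulas. -/
def conj {L : FirstOrder.Language.{0, 0}} {n : ℕ} (l : List (L.BoundedFormula Empty n)) :
    L.BoundedFormula Empty n :=
  l.foldr (· ⊓ ·) ⊤

/-- The disjunction of a list of formulas. -/
def disj {L : FirstOrder.Language.{0, 0}} {n : ℕ} (l : List (L.BoundedFormula Empty n)) :
    L.BoundedFormula Empty n :=
  l.foldr (· ⊔ ·) ⊥

/-- The axiom `m + n = k` for numerals, where `k` is the sum of `m` and `n`. -/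
def axAdd (m n : ℕ) : arith.Sentence :=
  BoundedFormula.equal (n := 0) (addTerm (numeral m) (numeral n)) (numeral (m + n))

/-- The axiom `m · n = k` for numerals, where `k` is the product of `m` and `n`. -/
def axMul (m n : ℕ) : arith.Sentence :=
  BoundedFormula.equal (n := 0) (mulTerm (numeral m) (numeral n)) (numeral (m * n))

/-- The sentence `m ≠ n` for numerals. -/
def axNe (m n : ℕ) : arith.Sentence :=
  (BoundedFormula.equal (n := 0) (numeral m) (numeral n)).not

/-- The axiom `∀ x (x ≤ n → x = 0 ∨ … ∨ x = n)`. -/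
def axBound (n : ℕ) : arith.Sentence :=
  BoundedFormula.all (n := 0) <|
    (leFormula (.var (.inr 0)) (numeral n)).imp
      (disj ((List.range (n + 1)).map fun i => (Term.var (.inr 0)).bdEqual (numeral i)))

/-- The axiom `∀ x (x ≤ n ∨ n ≤ x)`. -/
def axCompare (n : ℕ) : arith.Sentence :=
  BoundedFormula.all (n := 0) <|
    leFormula (.var (.inr 0)) (numeral n) ⊔ leFormula (numeral n) (.var (.inr 0))

/-- The theory R of Tarski, Mostowski and Robinson. -/
def theoryR : arith.Theory :=
  {φ | (∃ m n, φ = axAdd m n) ∨ (∃ m n, φ = axMul m n) ∨ (∃ m n, m ≠ n ∧ φ = axNe m n) ∨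
    (∃ n, φ = axBound n) ∨ (∃ n, φ = axCompare n)}

/-! ### Janiczak's theory J -/

/-- The only symbol of the language of J. -/
inductive EqvRel : ℕ → Type
  | E : EqvRel 2

/-- The language with one binary relation symbol `E`. -/
def eqvLang : FirstOrder.Language.{0, 0} :=
  ⟨fun _ => Empty, EqvRel⟩

instance : Encodable (Σ n, eqvLang.Functions n) :=
  Encodable.ofLeftInjection (fun x => (x.2 : Empty).elim) (fun _ : Empty => none)
    fun x => (x.2 : Empty).elim

instance : Encodable (Σ n, eqvLang.Relations n) :=
  Encodable.ofLeftInjection (fun _ => ()) (fun _ => some ⟨2, EqvRel.E⟩)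
    (fun ⟨_, r⟩ => by cases r; rfl)

section J

variable {N : ℕ}

/-- The formula `x_i E x_j`. -/
def rE (i j : Fin N) : eqvLang.BoundedFormula Empty N :=
  BoundedFormula.rel (L := eqvLang) EqvRel.E ![.var (.inr i), .var (.inr j)]

/-- The formula `x_i = x_j`. -/
def vEq (i j : Fin N) : eqvLang.BoundedFormula Empty N :=
  BoundedFormula.equal (.var (.inr i)) (.var (.inr j))

/-- ‘The variables `x_{f 0}, …, x_{f (k-1)}` are pairwise distinct.’ -/
def pairwiseNe {k : ℕ} (f : Fin k → Fin N) : eqvLang.BoundedFormula Empty N :=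
  conj ((List.finRange k).map fun i =>
    conj (((List.finRange k).filter fun j => i < j).map fun j => (vEq (f i) (f j)).not))

/-- ‘The variables `x_{f 0}, …, x_{f (k-1)}` are pairwise equivalent.’ -/
def pairwiseE {k : ℕ} (f : Fin k → Fin N) : eqvLang.BoundedFormula Empty N :=
  conj ((List.finRange k).map fun i => conj ((List.finRange k).map fun j => rE (f i) (f j)))

/-- ‘The variables `x_{f 0}, …, x_{f k}` enumerate without repetition an equivalence class.’ -/
def isClass {k : ℕ} (f : Fin (k + 1) → Fin N) : eqvLang.BoundedFormula Empty N :=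
  pairwiseNe f ⊓ pairwiseE f ⊓
    BoundedFormula.all ((rE (f 0).castSucc (Fin.last N)).imp
      (disj ((List.finRange (k + 1)).map fun i => vEq (Fin.last N) (f i).castSucc)))

/-- `E` is reflexive. -/
def axRefl : eqvLang.Sentence :=
  BoundedFormula.alls (n := 1) (rE 0 0)

/-- `E` is symmetric. -/
def axSymm : eqvLang.Sentence :=
  BoundedFormula.alls (n := 2) ((rE 0 1).imp (rE 1 0))

/-- `E` is transitive. -/
def axTrans : eqvLang.Sentence :=
  BoundedFormula.alls (n := 3) ((rE 0 1).imp ((rE 1 2).imp (rE 0 2)))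

/-- There is at most one equivalence class of size precisely `k + 1`. (No class has size `0`.) -/
def axUnique (k : ℕ) : eqvLang.Sentence :=
  BoundedFormula.alls (n := (k + 1) + (k + 1))
    ((isClass (Fin.castAdd (k + 1))).imp ((isClass (Fin.natAdd (k + 1))).imp
      (rE (Fin.castAdd (k + 1) 0) (Fin.natAdd (k + 1) 0))))

/-- There are at least `n` equivalence classes with at least `n` elements: there are `x_{i,j}` with
`i, j < n` such that, for every `i`, the `x_{i,j}` are distinct and equivalent, and such that
`x_{i,j}` and `x_{i',j'}` are not equivalent for `i < i'`. -/
def axMany (n : ℕ) : eqvLang.Sentence :=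
  BoundedFormula.exs (n := n * n)
    (conj ((List.finRange n).map fun i =>
        pairwiseNe (fun j : Fin n => finProdFinEquiv (i, j)) ⊓
        pairwiseE (fun j : Fin n => finProdFinEquiv (i, j))) ⊓
      conj ((List.finRange n).map fun i =>
        conj (((List.finRange n).filter fun i' => i < i').map fun i' =>
          conj ((List.finRange n).map fun j => conj ((List.finRange n).map fun j' =>
            (rE (finProdFinEquiv (i, j)) (finProdFinEquiv (i', j'))).not)))))

/-- Janiczak's theory J. -/
def theoryJ : eqvLang.Theory :=
  {φ | φ = axRefl ∨ φ = axSymm ∨ φ = axTrans ∨ (∃ k, φ = axUnique k) ∨ (∃ n, φ = axMany n)}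

/-- The sentence `A_n`: there is an equivalence class of size precisely `n + 1`. -/
def sentenceA (n : ℕ) : eqvLang.Sentence :=
  BoundedFormula.exs (n := n + 1) (isClass id)

/-- The theory `J + {A_n : n ∈ B} + {¬ A_n : n ∈ C}`. -/
def theoryT (B C : Set ℕ) : eqvLang.Theory :=
  theoryJ ∪ {φ | ∃ n ∈ B, φ = sentenceA n} ∪ {φ | ∃ n ∈ C, φ = (sentenceA n).not}

end J

end TuringPersistence

/-!
Let `A` be the set with index `e`. The pair `(B, C)` is built by racing enumerations: the number
`⟨i, x⟩` is put into `B` or `C` once `x` has appeared in `A`, into `B` if `x` was faster than the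
appearance of `⟨i, x⟩` in `W_i`, and into `C` otherwise (`LoAt`, `HiAt`). If a recursively
enumerable `D = W_i` separates `B` from `C`, then `x ∈ A` forces `⟨i, x⟩ ∈ D` and forces `x` to
appear in `A` before `⟨i, x⟩` appears in `D`, so `D` computes `A` (`turingLE_of_separates`).
Inseparability follows because `A` is not recursive. In the other direction `A` knows when its
elements `x ≤ m` have all appeared, and from then on `B` and `C` are decided up to `m`
(`turingLE_of_stage`).

A back-and-forth argument (`Similar.realize_iff`) shows that, in a model of Janiczak's theory, the
truth of a formula with at most `q` variables and quantifiers at a tuple depends only on equality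
and equivalence of the entries, on the sizes below `q` of their classes, and on the sizes below `q`
that occur at all. The number `q` can be taken to be the Gödel number of a sentence. This has three
uses.

* A sentence can be evaluated in a finite structure whose class sizes below `q` are prescribed by
  the digits of a number `c` (`realize_iff_evalSentence`), and this evaluation is primitive
  recursive. As all patterns of sizes occur in models of Janiczak's theory, the theorems of `T` are
  those sentences that hold for all `c` compatible with `B` and `C` (`models_iff`). So the theory is
  recursively enumerable, uniformly in `e`, and computable from `A`, without any appeal to a proof
  calculus.
* Whether a sentence is equivalent to `A_n` over Janiczak's theory is decidable, so a search finds
  the Gödel number of such a sentence (`exists_computable_sentenceA`). For every consistent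
  recursively enumerable extension `S` of `T`, the `n` for which `S` proves that sentence form a
  recursively enumerable set that separates `B` from `C` and hence computes `A`
  (`turingLE_provable`). This gives persistence and the degree; the same sentences transfer the
  inseparability of `(B, C)` to `T`.
* No formula orders an infinite sequence of blocks in a model of Janiczak's theory: for `i` and `j`
  that are generic for a nonprincipal ultrafilter, exchanging the blocks `i` and `j` changes none of
  the data above, since an equivalence relation between generic terms of two sequences is symmetric
  in `i` and `j` (`exists_lt_realize_swap_iff`). But an interpretation of R orders the blocks that
  represent the numerals by the translation of `≤` (`not_interprets_theoryR`).
-/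

open FirstOrder FirstOrder.Language

namespace TuringPersistence

/-! ### Enumeration in stages and Turing reductions -/

open Nat.Partrec (Code)

/-- `x` has been enumerated into the recursively enumerable set with index `e` by stage `s`. -/
def InStage (e : Code) (s x : ℕ) : Prop :=
  (Code.evaln s e x).isSome

instance (e : Code) (s x : ℕ) : Decidable (InStage e s x) :=
  inferInstanceAs (Decidable (_ = true))

theorem InStage.mono {e : Code} {s t x : ℕ} (h : InStage e s x) (hst : s ≤ t) :
    InStage e t x := by
  obtain ⟨y, hy⟩ := Option.isSome_iff_exists.1 h
  exact Option.isSome_iff_exists.2 ⟨y, Code.evaln_mono hst hy⟩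

theorem mem_reSet_iff {e : Code} {x : ℕ} : x ∈ reSet e ↔ ∃ s, InStage e s x := by
  constructor
  · intro h
    obtain ⟨y, hy⟩ := Part.dom_iff_mem.1 h
    obtain ⟨s, hs⟩ := Code.evaln_complete.1 hy
    exact ⟨s, Option.isSome_iff_exists.2 ⟨y, hs⟩⟩
  · rintro ⟨s, hs⟩
    obtain ⟨y, hy⟩ := Option.isSome_iff_exists.1 hs
    exact Part.dom_iff_mem.2 ⟨y, Code.evaln_sound hy⟩

theorem primrecPred_inStage {α : Type*} [Primcodable α] {e : α → Code} {s x : α → ℕ}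
    (he : Primrec e) (hs : Primrec s) (hx : Primrec x) :
    PrimrecPred fun a => InStage (e a) (s a) (x a) :=
  Primrec.primrecPred <|
    (Primrec.option_isSome.comp
      (Code.primrec_evaln.comp (((hs.pair he).pair hx)))).of_eq fun a => by
        rw [Bool.eq_iff_iff, decide_eq_true_iff]; rfl

theorem isRE_reSet (e : Code) : IsRE (reSet e) :=
  Partrec.dom_re (Partrec.nat_iff.2 (Code.exists_code.2 ⟨e, rfl⟩))

theorem IsRE.exists_index {D : Set ℕ} (h : IsRE D) : ∃ e : Code, reSet e = D := by
  obtain ⟨e, he⟩ := Code.exists_code.1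
    (Partrec.nat_iff.1 (h.map (Computable.const 0).to₂))
  refine ⟨e, Set.ext fun n => ?_⟩
  simp [reSet, he, Part.assert]

/-- A set that is enumerated in stages, primitive recursively in an index `e`, has an index that is
computable from `e`, by the s-m-n theorem. -/
theorem exists_computable_index {P : Code → ℕ → ℕ → Prop}
    (hP : PrimrecPred fun p : (Code × ℕ) × ℕ => P p.1.1 p.1.2 p.2) :
    ∃ b : Code → Code, Computable b ∧ ∀ e, reSet (b e) = {n | ∃ s, P e n s} := by
  classical
  have h1 : Partrec fun p : Code × ℕ => Nat.rfind fun s => Part.some (decide (P p.1 p.2 s)) :=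
    Partrec.rfind (Computable.partrec (hP.computablePred.decide))
  obtain ⟨c, hc⟩ := Code.exists_code.1 (show Nat.Partrec fun k => _ from
    Partrec.nat_iff.1 (h1.comp (((Computable.ofNat Code).comp
      (Computable.fst.comp Computable.unpair)).pair (Computable.snd.comp Computable.unpair))))
  refine ⟨fun e => Code.curry c (Encodable.encode e),
    (Code.primrec₂_curry.comp (Primrec.const c) Primrec.encode).to_comp, fun e => ?_⟩
  ext n
  simp only [reSet, Code.eval_curry, hc, Set.mem_ofPred_eq, Nat.unpair_pair,
    Denumerable.ofNat_encode]
  refine Nat.rfind_dom.trans ?_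
  simp

theorem charFun_eq_of_mem {A : Set ℕ} {n : ℕ} (h : n ∈ A) : charFun A n = Part.some 1 := by
  simp [charFun, h]

theorem charFun_eq_of_notMem {A : Set ℕ} {n : ℕ} (h : n ∉ A) : charFun A n = Part.some 0 := by
  simp [charFun, h]

theorem recursiveIn_comp {O : Set (ℕ →. ℕ)} {q : ℕ →. ℕ} (hq : Nat.RecursiveIn O q) {g : ℕ → ℕ}
    (hg : Computable g) : Nat.RecursiveIn O fun n => q (g n) :=
  (Nat.RecursiveIn.comp hq (Partrec.nat_iff.1 hg.partrec).recursiveIn).of_eq fun n =>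
    Part.bind_some (g n) q

theorem recursiveIn_bind {O : Set (ℕ →. ℕ)} {q h : ℕ →. ℕ} (hq : Nat.RecursiveIn O q)
    (hh : Partrec h) : Nat.RecursiveIn O fun n => (q n).bind fun v => h (Nat.pair n v) := by
  refine (Nat.RecursiveIn.comp (Partrec.nat_iff.1 hh).recursiveIn
    (Nat.RecursiveIn.pair (Partrec.nat_iff.1 Computable.id.partrec).recursiveIn hq)).of_eq
      fun n => ?_
  change Part.bind _ _ = _
  simp only [Seq.seq, PFun.coe_val, id, Part.map_eq_map, Part.bind_some,
    ← Part.bind_some_eq_map]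
  exact (Part.bind_assoc _ _ _).trans (congrArg _ (funext fun v => Part.bind_some _ _))

/-- A set that can be decided after a single query to the oracle `D` is Turing reducible to `D`. -/
theorem turingLE_of_query {A D : Set ℕ} {g : ℕ → ℕ} (hg : Computable g) {h : ℕ →. ℕ}
    (hh : Partrec h)
    (h₀ : ∀ n, g n ∉ D → charFun A n = h (Nat.pair n 0))
    (h₁ : ∀ n, g n ∈ D → charFun A n = h (Nat.pair n 1)) : TuringLE A D := by
  refine RecursiveIn.iff_nat.2 ((recursiveIn_bind
    (recursiveIn_comp (.oracle (charFun D) (Set.mem_singleton _)) hg) hh).of_eq fun n => ?_)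
  by_cases hn : g n ∈ D
  · rw [h₁ n hn, charFun_eq_of_mem hn, Part.bind_some]
  · rw [h₀ n hn, charFun_eq_of_notMem hn, Part.bind_some]

/-- If a stage `s` by which all elements `x ≤ m` of a recursively enumerable set `A` have appeared
is enough to decide whether `m` is in `P`, then `P` is Turing reducible to `A`: the oracle `A` finds
such a stage. -/
theorem turingLE_of_stage {P : Set ℕ} {e : Code} {R : ℕ → ℕ → Prop}
    (hR : ComputablePred fun p : ℕ × ℕ => R p.1 p.2)
    (h : ∀ m s, (∀ x ≤ m, x ∈ reSet e → InStage e s x) → (m ∈ P ↔ R m s)) :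
    TuringLE P (reSet e) := by
  classical
  set A := reSet e with hA
  -- `step x s v` is a stage `≥ s` at which `x` has appeared, provided that `v ≠ 0`.
  let step : ℕ → ℕ → ℕ →. ℕ := fun x s v =>
    Nat.rfind fun t => Part.some (decide (s ≤ t ∧ (v = 0 ∨ InStage e t x)))
  have hstep : Partrec fun k : ℕ =>
      step k.unpair.1.unpair.2.unpair.1 k.unpair.1.unpair.2.unpair.2 k.unpair.2 := by
    refine Partrec.rfind (Computable.partrec (PrimrecPred.computablePred ?_).decide)
    have hk : Primrec fun p : ℕ × ℕ => p.1.unpair := Primrec.unpair.comp Primrec.fst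
    have hk2 : Primrec fun p : ℕ × ℕ => p.1.unpair.1.unpair.2.unpair :=
      Primrec.unpair.comp (Primrec.snd.comp (Primrec.unpair.comp (Primrec.fst.comp hk)))
    exact (Primrec.nat_le.comp (Primrec.snd.comp hk2) Primrec.snd).and
      ((Primrec.eq.comp (Primrec.snd.comp hk) (Primrec.const 0)).or
        (primrecPred_inStage (Primrec.const e) Primrec.snd (Primrec.fst.comp hk2)))
  -- One step of the search asks the oracle about `x` and then runs `step`; iterating it over all
  -- `x ≤ m` gives the required stage.
  have hnext := recursiveIn_bind (recursiveIn_comp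
    (.oracle (charFun A) (Set.mem_singleton _)) (g := fun k => k.unpair.2.unpair.1)
      (Computable.fst.comp (Computable.unpair.comp (Computable.snd.comp Computable.unpair)))) hstep
  have hmod := recursiveIn_comp (Nat.RecursiveIn.prec .zero hnext)
    (g := fun m => Nat.pair 0 (m + 1))
    (Primrec₂.natPair.comp (Primrec.const 0) Primrec.succ).to_comp
  have hdec : Partrec fun k : ℕ =>
      (Part.some (if R k.unpair.1 k.unpair.2 then 1 else 0) : Part ℕ) :=
    (Computable.cond (hR.decide.comp Computable.unpair) (Computable.const 1)
      (Computable.const 0)).partrec.of_eq fun k => by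
        by_cases hk : R k.unpair.1 k.unpair.2 <;> simp [hk]
  refine RecursiveIn.iff_nat.2 ((recursiveIn_bind hmod hdec).of_eq fun m => ?_)
  have key : ∀ n : ℕ, ∃ s, (∀ x < n, x ∈ A → InStage e s x) ∧
      (Nat.rec (motive := fun _ => Part ℕ) (Part.some 0) (fun y IH => IH.bind fun i =>
        (charFun A y).bind fun v => step y i v) n) = Part.some s := by
    intro n
    induction n with
    | zero => exact ⟨0, by simp, rfl⟩
    | succ n ih =>
      obtain ⟨s, hs, h'⟩ := ih
      have : ∃ t, s ≤ t ∧ (n ∉ A ∨ InStage e t n) := by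
        by_cases hn : n ∈ A
        · obtain ⟨t, ht⟩ := mem_reSet_iff.1 hn
          exact ⟨max s t, le_max_left _ _, .inr (ht.mono (le_max_right _ _))⟩
        · exact ⟨s, le_rfl, .inl hn⟩
      obtain ⟨v, hv, hv'⟩ : ∃ v, charFun A n = Part.some v ∧ (v = 0 ↔ n ∉ A) := by
        by_cases hn : n ∈ A
        · exact ⟨1, charFun_eq_of_mem hn, by simp [hn]⟩
        · exact ⟨0, charFun_eq_of_notMem hn, by simp [hn]⟩
      have hd : (step n s v).Dom := by
        obtain ⟨t, ht⟩ := this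
        exact Nat.rfind_dom.2 ⟨t, by simpa [hv'] using ht, by simp⟩
      obtain ⟨t, ht⟩ := Part.dom_iff_mem.1 hd
      have ht' := Nat.rfind_spec ht
      simp only [Part.mem_some_iff, true_eq_decide_iff, hv'] at ht'
      refine ⟨t, fun x hx hxA => ?_, ?_⟩
      · rcases Nat.lt_succ_iff_lt_or_eq.1 hx with hx | rfl
        · exact (hs x hx hxA).mono ht'.1
        · exact ht'.2.resolve_left (by simpa using hxA)
      · simp only [h', hv, Part.bind_some]
        exact Part.eq_some_iff.2 ht
  obtain ⟨s, hs, h'⟩ := key (m + 1)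
  have hP := h m s fun x hx => hs x (Nat.lt_succ_of_le hx)
  simp only [Nat.unpair_pair, Part.bind_eq_bind]
  refine (congrArg (fun p => Part.bind p _) h').trans ?_
  simp only [Part.bind_some, charFun, hP]

theorem TuringLE.trans {A B C : Set ℕ} (h₁ : TuringLE A B) (h₂ : TuringLE B C) : TuringLE A C :=
  TuringReducible.trans h₁ h₂

theorem IsRecursive.turingLE {X : Set ℕ} (hX : IsRecursive X) (B : Set ℕ) : TuringLE X B := by
  classical
  refine Partrec.turingReducible ?_
  exact (Computable.cond hX.decide (Computable.const 1)
      (Computable.const 0)).partrec.of_eq fun k => by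
        by_cases hk : k ∈ X <;> simp [hk, charFun]

theorem turingLE_preimage {D : Set ℕ} {g : ℕ → ℕ} (hg : Computable g) : TuringLE (g ⁻¹' D) D := by
  refine turingLE_of_query (h := fun k => Part.some k.unpair.2) hg
    (Computable.snd.comp Computable.unpair).partrec (fun n hn => ?_) (fun n hn => ?_)
  · rw [charFun_eq_of_notMem (by simpa using hn), Nat.unpair_pair]
  · rw [charFun_eq_of_mem (by simpa using hn), Nat.unpair_pair]

theorem degree_eq_of_turingLE {A B : Set ℕ} (h₁ : TuringLE A B) (h₂ : TuringLE B A) :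
    degree A = degree B :=
  Quotient.sound ⟨h₁, h₂⟩

theorem isRecursive_empty : IsRecursive ∅ :=
  ⟨fun _ => .isFalse (by simp), (Computable.const false).of_eq fun _ => by simp⟩

/-- A set that is Turing reducible to a recursive set has the degree of the empty set. -/
theorem degree_eq_degree_empty {A X : Set ℕ} (h : TuringLE A X) (hX : IsRecursive X) :
    degree A = degree ∅ :=
  degree_eq_of_turingLE (h.trans (hX.turingLE _)) (isRecursive_empty.turingLE _)

theorem IsRE.preimage {D : Set ℕ} (hD : IsRE D) {g : ℕ → ℕ} (hg : Computable g) :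
    IsRE (g ⁻¹' D) :=
  Partrec.comp hD hg

theorem IsRecursive.preimage {D : Set ℕ} (hD : IsRecursive D) {g : ℕ → ℕ} (hg : Computable g) :
    IsRecursive (g ⁻¹' D) := by
  obtain ⟨f, hf, h⟩ := ComputablePred.computable_iff.1 hD
  exact ComputablePred.computable_iff.2 ⟨_, hf.comp hg, funext fun n => congrFun h (g n)⟩

/-! ### The inseparable pair -/

/-- At stage `s` it is known that the number `n = ⟨i, x⟩` enters the first set of the pair: `x` has
appeared in the set with index `e`, strictly before `n` has appeared in the set with index `i`. -/
def LoAt (e : Code) (s n : ℕ) : Prop :=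
  InStage e s n.unpair.2 ∧
    ∃ r < s + 1, InStage e r n.unpair.2 ∧ ¬ InStage (Denumerable.ofNat Code n.unpair.1) r n

/-- At stage `s` it is known that the number `n = ⟨i, x⟩` enters the second set of the pair: `x` has
appeared in the set with index `e`, but not before `n` has appeared in the set with index `i`. -/
def HiAt (e : Code) (s n : ℕ) : Prop :=
  InStage e s n.unpair.2 ∧
    ∀ r < s + 1, InStage e r n.unpair.2 → InStage (Denumerable.ofNat Code n.unpair.1) r n

/-- Once `x` has appeared in `A`, the number `⟨i, x⟩` has been put into one of the two sets. -/
theorem loAt_or_hiAt {e : Code} {s n : ℕ} (h : InStage e s n.unpair.2) :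
    LoAt e s n ∨ HiAt e s n := by
  by_cases h' : ∀ r < s + 1, InStage e r n.unpair.2 →
      InStage (Denumerable.ofNat Code n.unpair.1) r n
  · exact .inr ⟨h, h'⟩
  · push Not at h'
    exact .inl ⟨h, h'⟩

theorem LoAt.not_hiAt {e : Code} {s t n : ℕ} (h : LoAt e s n) : ¬ HiAt e t n := by
  obtain ⟨-, r, -, h₁, h₂⟩ := h
  rintro ⟨h₃, h₄⟩
  rcases Nat.lt_or_ge r (t + 1) with hr | hr
  · exact h₂ (h₄ r hr h₁)
  · exact h₂ ((h₄ t (Nat.lt_succ_self t) h₃).mono (by omega))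

theorem primrecPred_atStage :
    (PrimrecPred fun p : (Code × ℕ) × ℕ => LoAt p.1.1 p.2 p.1.2) ∧
      PrimrecPred fun p : (Code × ℕ) × ℕ => HiAt p.1.1 p.2 p.1.2 := by
  have hx : Primrec fun p : (Code × ℕ) × ℕ => p.1.2.unpair :=
    Primrec.unpair.comp (Primrec.snd.comp Primrec.fst)
  have h0 : PrimrecPred fun p : (Code × ℕ) × ℕ => InStage p.1.1 p.2 p.1.2.unpair.2 :=
    primrecPred_inStage (Primrec.fst.comp Primrec.fst) Primrec.snd (Primrec.snd.comp hx)
  have h1 : PrimrecRel fun (r : ℕ) (p : (Code × ℕ) × ℕ) => InStage p.1.1 r p.1.2.unpair.2 :=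
    primrecPred_inStage (Primrec.fst.comp (Primrec.fst.comp Primrec.snd)) Primrec.fst
      (Primrec.snd.comp (hx.comp Primrec.snd))
  have h2 : PrimrecRel fun (r : ℕ) (p : (Code × ℕ) × ℕ) =>
      InStage (Denumerable.ofNat Code p.1.2.unpair.1) r p.1.2 :=
    primrecPred_inStage ((Primrec.ofNat Code).comp (Primrec.fst.comp (hx.comp Primrec.snd)))
      Primrec.fst (Primrec.snd.comp (Primrec.fst.comp Primrec.snd))
  have hr : Primrec fun p : (Code × ℕ) × ℕ => List.range (p.2 + 1) :=
    Primrec.list_range.comp (Primrec.succ.comp Primrec.snd)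
  have h3 : PrimrecRel fun (r : ℕ) (p : (Code × ℕ) × ℕ) => InStage p.1.1 r p.1.2.unpair.2 ∧
      ¬ InStage (Denumerable.ofNat Code p.1.2.unpair.1) r p.1.2 := PrimrecPred.and h1 h2.not
  constructor
  · exact (h0.and (h3.exists_mem_list.comp hr Primrec.id)).of_eq fun p => by simp [LoAt]
  · exact (h0.and (h3.not.forall_mem_list.comp hr Primrec.id)).of_eq fun p => by simp [HiAt]

/-- The first set of the inseparable pair. -/
def loSet (e : Code) : Set ℕ :=
  {n | ∃ s, LoAt e s n}

/-- The second set of the inseparable pair. -/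
def hiSet (e : Code) : Set ℕ :=
  {n | ∃ s, HiAt e s n}

variable {e : Code}

theorem disjoint_loSet_hiSet : Disjoint (loSet e) (hiSet e) :=
  Set.disjoint_left.2 fun _ ⟨_, h⟩ ⟨_, h'⟩ => h.not_hiAt h'

theorem mem_loSet_iff {n s : ℕ} (h : n.unpair.2 ∈ reSet e → InStage e s n.unpair.2) :
    n ∈ loSet e ↔ LoAt e s n :=
  ⟨fun ⟨t, ht⟩ => (loAt_or_hiAt (h (mem_reSet_iff.2 ⟨t, ht.1⟩))).resolve_right ht.not_hiAt,
    fun h => ⟨s, h⟩⟩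

theorem mem_hiSet_iff {n s : ℕ} (h : n.unpair.2 ∈ reSet e → InStage e s n.unpair.2) :
    n ∈ hiSet e ↔ HiAt e s n :=
  ⟨fun ⟨t, ht⟩ => (loAt_or_hiAt (h (mem_reSet_iff.2 ⟨t, ht.1⟩))).resolve_left
    fun h' => h'.not_hiAt ht, fun h => ⟨s, h⟩⟩

theorem loSet_turingLE : TuringLE (loSet e) (reSet e) := by
  refine turingLE_of_stage (R := fun n s => LoAt e s n)
    (primrecPred_atStage.1.comp ((Primrec.const e).pair Primrec.fst |>.pair
      Primrec.snd)).computablePred fun n s h => mem_loSet_iff (h _ (Nat.unpair_right_le n))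

theorem hiSet_turingLE : TuringLE (hiSet e) (reSet e) := by
  refine turingLE_of_stage (R := fun n s => HiAt e s n)
    (primrecPred_atStage.2.comp ((Primrec.const e).pair Primrec.fst |>.pair
      Primrec.snd)).computablePred fun n s h => mem_hiSet_iff (h _ (Nat.unpair_right_le n))

/-- If `D` is a recursively enumerable separating set with index `i`, then every `x` in the set `A`
with index `e` appears in `A` before `⟨i, x⟩` appears in `D`; so `D` computes `A`. -/
theorem turingLE_of_separates {D : Set ℕ} (hD : IsRE D)
    (hsep : Separates D (loSet e) (hiSet e)) : TuringLE (reSet e) D := by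
  classical
  obtain ⟨i, rfl⟩ := hD.exists_index
  set g : ℕ → ℕ := fun x => Nat.pair (Encodable.encode i) x with hg
  have hgp : Primrec g := Primrec₂.natPair.comp (Primrec.const _) Primrec.id
  have key : ∀ x ∈ reSet e, g x ∈ reSet i ∧ ∀ s, InStage i s (g x) → InStage e s x := by
    intro x hx
    obtain ⟨s, hs⟩ := mem_reSet_iff.1 hx
    rcases loAt_or_hiAt (n := g x) (s := s) (by simpa [hg] using hs) with h | h
    · refine ⟨hsep.1 ⟨s, h⟩, fun t ht => ?_⟩
      obtain ⟨-, r, -, h₁, h₂⟩ := h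
      simp only [hg, Nat.unpair_pair, Denumerable.ofNat_encode] at h₁ h₂
      exact h₁.mono (le_of_lt (not_le.1 fun htr => h₂ (ht.mono htr)))
    -- The second alternative would put an element of `D` into the set that `D` has to avoid.
    · refine absurd (show g x ∈ hiSet e from ⟨s, h⟩) (Set.disjoint_left.1 hsep.2 ?_)
      have := h.2 s (Nat.lt_succ_self s) h.1
      simp only [hg, Nat.unpair_pair, Denumerable.ofNat_encode] at this
      exact mem_reSet_iff.2 ⟨s, this⟩
  -- The answer to the query is `v`; for `v ≠ 0`, the least stage that contains `g x` decides `x`.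
  let f : ℕ →. ℕ := fun k => (Nat.rfind fun s => Part.some
    (decide (k.unpair.2 = 0 ∨ InStage i s (g k.unpair.1)))).map fun s =>
      if k.unpair.2 ≠ 0 ∧ InStage e s k.unpair.1 then 1 else 0
  have hk : Primrec fun p : ℕ × ℕ => p.1.unpair := Primrec.unpair.comp Primrec.fst
  have hf : Partrec f := by
    refine Partrec.map (Partrec.rfind (Computable.partrec (PrimrecPred.computablePred ?_).decide))
      (Primrec.ite ?_ (Primrec.const 1) (Primrec.const 0)).to_comp
    · exact (Primrec.eq.comp (Primrec.snd.comp hk) (Primrec.const 0)).or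
        (primrecPred_inStage (Primrec.const i) Primrec.snd (hgp.comp (Primrec.fst.comp hk)))
    · exact (Primrec.eq.comp (Primrec.snd.comp hk) (Primrec.const 0)).not.and
        (primrecPred_inStage (Primrec.const e) Primrec.snd (Primrec.fst.comp hk))
  refine turingLE_of_query hgp.to_comp hf (fun x hx => ?_) (fun x hx => ?_)
  · rw [charFun_eq_of_notMem fun h => hx (key x h).1]
    refine (Part.eq_some_iff.2 (Part.mem_map_iff _ |>.2 ⟨0, ?_, ?_⟩)).symm
    · exact Nat.mem_rfind.2 ⟨by simp, by simp⟩
    · simp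
  · have hdom : (Nat.rfind fun s => Part.some (decide (InStage i s (g x)))).Dom := by
      obtain ⟨s, hs⟩ := mem_reSet_iff.1 hx
      exact Nat.rfind_dom.2 ⟨s, by simpa using hs, by simp⟩
    obtain ⟨s, hs⟩ := Part.dom_iff_mem.1 hdom
    have hs' : InStage i s (g x) := by simpa using Nat.rfind_spec hs
    have hx' : x ∈ reSet e ↔ InStage e s x :=
      ⟨fun h => (key x h).2 s hs', fun h => mem_reSet_iff.2 ⟨s, h⟩⟩
    refine (Part.eq_some_iff.2 (Part.mem_map_iff _ |>.2 ⟨s, ?_, ?_⟩)).symm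
    · simpa using hs
    · simp [hx']

theorem isRE_setOf_exists {P : ℕ → ℕ → Prop}
    (hP : PrimrecPred fun p : ℕ × ℕ => P p.1 p.2) : IsRE {n | ∃ s, P n s} := by
  obtain ⟨b, -, hb⟩ := exists_computable_index (P := fun _ n s => P n s)
    (hP.comp ((Primrec.snd.comp Primrec.fst).pair Primrec.snd))
  rw [← hb Code.zero]
  exact isRE_reSet _

theorem isRE_loSet : IsRE (loSet e) :=
  isRE_setOf_exists (primrecPred_atStage.1.comp ((Primrec.const e).pair Primrec.fst |>.pair
    Primrec.snd))

theorem isRE_hiSet : IsRE (hiSet e) :=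
  isRE_setOf_exists (primrecPred_atStage.2.comp ((Primrec.const e).pair Primrec.fst |>.pair
    Primrec.snd))

theorem IsRecursive.isRE {X : Set ℕ} (hX : IsRecursive X) : IsRE X :=
  ComputablePred.to_re hX

theorem isRIPair_loSet_hiSet (he : degree (reSet e) ≠ degree ∅) :
    IsRIPair (loSet e) (hiSet e) :=
  ⟨isRE_loSet, isRE_hiSet, disjoint_loSet_hiSet, fun ⟨_, hX, hsep⟩ =>
    he (degree_eq_degree_empty (turingLE_of_separates hX.isRE hsep) hX)⟩

/-! ### Primitive recursion on Gödel numbers of formulas -/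

/-- The immediate subformulas of the formula with Gödel number `m`, with their assignments. In a
triple `(D, v, m)`, `v` lists the values of the free variables, and `D` lists the values of a
quantified variable. -/
def children (b : List ℕ × List ℕ × ℕ) : List (List ℕ × List ℕ × ℕ) :=
  if b.2.2.unpair.1 = 3 then
    [(b.1, b.2.1, b.2.2.unpair.2.unpair.1), (b.1, b.2.1, b.2.2.unpair.2.unpair.2)]
  else if b.2.2.unpair.1 = 4 then b.1.map fun x => (b.1, b.2.1 ++ [x], b.2.2.unpair.2)
  else []

theorem unpair_snd_lt {m : ℕ} (h : 0 < m.unpair.1) : m.unpair.2 < m := by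
  have := Nat.add_le_pair m.unpair.1 m.unpair.2
  rw [Nat.pair_unpair] at this
  omega

theorem lt_of_mem_children {b b' : List ℕ × List ℕ × ℕ} (h : b' ∈ children b) :
    b'.2.2 < b.2.2 := by
  unfold children at h
  split_ifs at h with h₁ h₂
  · have h₃ := unpair_snd_lt (m := b.2.2) (by omega)
    have h₄ := Nat.unpair_left_le b.2.2.unpair.2
    have h₅ := Nat.unpair_right_le b.2.2.unpair.2
    simp only [List.mem_cons, List.not_mem_nil, or_false] at h
    rcases h with rfl | rfl <;> dsimp only <;> omega
  · obtain ⟨x, -, rfl⟩ := List.mem_map.1 h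
    exact unpair_snd_lt (m := b.2.2) (by omega)
  · simp at h

/-- Recursion on Gödel numbers of formulas: `f` combines the values at the immediate subformulas. -/
def foldNumber (f : List ℕ × List ℕ × ℕ → List Bool → Bool) (b : List ℕ × List ℕ × ℕ) : Bool :=
  f b ((children b).attach.map fun b' => foldNumber f b'.1)
termination_by b.2.2
decreasing_by exact lt_of_mem_children b'.2

theorem foldNumber_eq (f : List ℕ × List ℕ × ℕ → List Bool → Bool) (b : List ℕ × List ℕ × ℕ) :
    foldNumber f b = f b ((children b).map (foldNumber f)) := by
  conv_lhs => rw [foldNumber]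
  simp

section Primrec

open Primrec

theorem primrec_tag : Primrec fun b : List ℕ × List ℕ × ℕ => b.2.2.unpair.1 :=
  fst.comp (unpair.comp (snd.comp snd))

theorem primrec_body : Primrec fun b : List ℕ × List ℕ × ℕ => b.2.2.unpair.2 :=
  snd.comp (unpair.comp (snd.comp snd))

theorem primrec_body_unpair : Primrec fun b : List ℕ × List ℕ × ℕ => b.2.2.unpair.2.unpair :=
  unpair.comp primrec_body

theorem primrec_children : Primrec children := by
  have h1 : Primrec fun b : List ℕ × List ℕ × ℕ => b.2.1 := fst.comp snd
  refine ite (Primrec.eq.comp primrec_tag (const 3)) ?_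
    (ite (Primrec.eq.comp primrec_tag (const 4)) ?_ (const []))
  · exact list_cons.comp (fst.pair (h1.pair (fst.comp primrec_body_unpair)))
      (list_cons.comp (fst.pair (h1.pair (snd.comp primrec_body_unpair))) (const []))
  · refine list_map fst ?_
    exact (fst.comp fst).pair ((list_concat.comp (h1.comp fst) snd).pair (primrec_body.comp fst))

theorem primrec_foldNumber {f : List ℕ × List ℕ × ℕ → List Bool → Bool} (hf : Primrec₂ f) :
    Primrec (foldNumber f) :=
  nat_omega_rec' (foldNumber f) (m := fun b => b.2.2) (snd.comp snd) primrec_children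
    (g := fun b rs => some (f b rs)) (option_some.comp₂ hf) (fun _ _ => lt_of_mem_children)
    fun b => by rw [foldNumber_eq f b]

/-- The arguments of the relation symbol of an atomic formula. -/
def relArgs (m : ℕ) : List ℕ :=
  Denumerable.ofNat (List ℕ) m.unpair.2.unpair.2

/-- `t` is the Gödel number of one of the variables `x_0, …, x_{n-1}`. -/
def isVarNumber (n t : ℕ) : Bool :=
  decide (t.unpair.1 = 0 ∧ t.unpair.2 < n)

/-- One step of the recursive test whether a number is the Gödel number of a formula. The symbol `E`
is encoded by `0`. -/
def wfStep (b : List ℕ × List ℕ × ℕ) (rs : List Bool) : Bool :=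
  if b.2.2.unpair.1 = 0 then decide (b.2.2.unpair.2 = 0)
  else if b.2.2.unpair.1 = 1 then
    isVarNumber b.2.1.length b.2.2.unpair.2.unpair.1 &&
      isVarNumber b.2.1.length b.2.2.unpair.2.unpair.2
  else if b.2.2.unpair.1 = 2 then
    decide (b.2.2.unpair.2.unpair.1 = 0 ∧ (relArgs b.2.2).length = 2) &&
      (isVarNumber b.2.1.length ((relArgs b.2.2).getD 0 0) &&
        isVarNumber b.2.1.length ((relArgs b.2.2).getD 1 0))
  else if b.2.2.unpair.1 < 5 then rs.getD 0 true && rs.getD 1 true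
  else false

/-- One step of the evaluation of a formula in a finite structure. -/
def evalStep (b : List ℕ × List ℕ × ℕ) (rs : List Bool) : Bool :=
  if b.2.2.unpair.1 = 0 then false
  else if b.2.2.unpair.1 = 1 then
    decide (b.2.1.getD b.2.2.unpair.2.unpair.1.unpair.2 0 =
      b.2.1.getD b.2.2.unpair.2.unpair.2.unpair.2 0)
  else if b.2.2.unpair.1 = 2 then
    decide ((b.2.1.getD ((relArgs b.2.2).getD 0 0).unpair.2 0).unpair.1 =
      (b.2.1.getD ((relArgs b.2.2).getD 1 0).unpair.2 0).unpair.1)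
  else if b.2.2.unpair.1 = 3 then !rs.getD 0 true || rs.getD 1 true
  else decide (∀ r ∈ rs, r = true)

theorem primrec_relArgs : Primrec fun b : List ℕ × List ℕ × ℕ => relArgs b.2.2 :=
  (Primrec.ofNat (List ℕ)).comp (snd.comp primrec_body_unpair)

theorem primrec₂_isVarNumber : Primrec₂ isVarNumber :=
  (PrimrecPred.and (Primrec.eq.comp (fst.comp (unpair.comp snd)) (const 0))
    (nat_lt.comp (snd.comp (unpair.comp snd)) fst)).decide

theorem primrec₂_wfStep : Primrec₂ wfStep := by
  have hlen : Primrec fun p : (List ℕ × List ℕ × ℕ) × List Bool => p.1.2.1.length :=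
    list_length.comp (fst.comp (snd.comp fst))
  have hargs := primrec_relArgs.comp (fst : Primrec (@Prod.fst _ (List Bool)))
  have hb := primrec_body_unpair.comp (fst : Primrec (@Prod.fst _ (List Bool)))
  have htag := primrec_tag.comp (fst : Primrec (@Prod.fst _ (List Bool)))
  refine ite (Primrec.eq.comp htag (const 0))
    (Primrec.eq.comp (primrec_body.comp fst) (const 0)).decide
    (ite (Primrec.eq.comp htag (const 1)) ?_ (ite (Primrec.eq.comp htag (const 2)) ?_
      (ite (nat_lt.comp htag (const 5)) ?_ (const false))))
  · exact Primrec.and.comp (primrec₂_isVarNumber.comp hlen (fst.comp hb))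
      (primrec₂_isVarNumber.comp hlen (snd.comp hb))
  · exact Primrec.and.comp ((Primrec.eq.comp (fst.comp hb) (const 0)).and
        (Primrec.eq.comp (list_length.comp hargs) (const 2))).decide
      (Primrec.and.comp
        (primrec₂_isVarNumber.comp hlen ((list_getD 0).comp hargs (const 0)))
        (primrec₂_isVarNumber.comp hlen ((list_getD 0).comp hargs (const 1))))
  · exact Primrec.and.comp ((list_getD true).comp snd (const 0))
      ((list_getD true).comp snd (const 1))

theorem primrec₂_evalStep : Primrec₂ evalStep := by
  have hv : Primrec fun p : (List ℕ × List ℕ × ℕ) × List Bool => p.1.2.1 :=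
    fst.comp (snd.comp fst)
  have hargs := primrec_relArgs.comp (fst : Primrec (@Prod.fst _ (List Bool)))
  have hb := primrec_body_unpair.comp (fst : Primrec (@Prod.fst _ (List Bool)))
  have htag := primrec_tag.comp (fst : Primrec (@Prod.fst _ (List Bool)))
  refine ite (Primrec.eq.comp htag (const 0)) (const false)
    (ite (Primrec.eq.comp htag (const 1)) ?_ (ite (Primrec.eq.comp htag (const 2)) ?_
      (ite (Primrec.eq.comp htag (const 3)) ?_ ?_)))
  · exact (Primrec.eq.comp
      ((list_getD 0).comp hv (snd.comp (unpair.comp (fst.comp hb))))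
      ((list_getD 0).comp hv (snd.comp (unpair.comp (snd.comp hb))))).decide
  · exact (Primrec.eq.comp
      (fst.comp (unpair.comp ((list_getD 0).comp hv
        (snd.comp (unpair.comp ((list_getD 0).comp hargs (const 0)))))))
      (fst.comp (unpair.comp ((list_getD 0).comp hv
        (snd.comp (unpair.comp ((list_getD 0).comp hargs (const 1)))))))).decide
  · exact Primrec.or.comp (Primrec.not.comp ((list_getD true).comp snd (const 0)))
      ((list_getD true).comp snd (const 1))
  · exact ((PrimrecPred.forall_mem_list (p := fun r : Bool => r = true)
      (Primrec.eq.comp Primrec.id (const true))).comp snd).decide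

end Primrec

/-- `m` is the Gödel number of a formula whose free variables are `x_0, …, x_{n-1}`, where `n` is
the length of `v`. The list `[0]` of values makes the recursion visit every subformula. -/
def isFormulaNumber (v : List ℕ) (m : ℕ) : Bool :=
  foldNumber wfStep ([0], v, m)

/-- The truth value, in the finite structure with universe `D`, of the formula with Gödel number
`m` under the assignment `v`. -/
def evalNumber (D v : List ℕ) (m : ℕ) : Bool :=
  foldNumber evalStep (D, v, m)

theorem exists_termNumber_eq {n t : ℕ} (h : isVarNumber n t = true) :
    ∃ i : Fin n, termNumber (L := eqvLang) (.var (.inr i)) = t := by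
  simp only [isVarNumber, decide_eq_true_eq] at h
  exact ⟨⟨_, h.2⟩, (congrArg (fun k => Nat.pair k _) h.1.symm).trans (Nat.pair_unpair t)⟩

/-- The language has no function symbols, so all terms are variables. -/
theorem exists_termNumber (n : ℕ) (t : eqvLang.Term (Empty ⊕ Fin n)) :
    ∃ i : Fin n, t = .var (.inr i) := by
  rcases t with (x | i) | f
  · exact x.elim
  · exact ⟨i, rfl⟩
  · exact Empty.elim f

theorem isVarNumber_var {n : ℕ} (i : Fin n) :
    isVarNumber n (termNumber (L := eqvLang) (.var (.inr i))) = true := by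
  simp [isVarNumber, termNumber]

theorem relArgs_formulaNumber {n : ℕ} (i j : Fin n) :
    relArgs (formulaNumber (rE i j)) = [Nat.pair 0 i, Nat.pair 0 j] := by
  simp [relArgs, rE, formulaNumber, termNumber]

theorem exists_rel_eq {n k : ℕ} (R : eqvLang.Relations k)
    (ts : Fin k → eqvLang.Term (Empty ⊕ Fin n)) :
    ∃ i j : Fin n, BoundedFormula.rel R ts = rE i j := by
  cases R
  obtain ⟨i, hi⟩ := exists_termNumber n (ts 0)
  obtain ⟨j, hj⟩ := exists_termNumber n (ts 1)
  refine ⟨i, j, congrArg (BoundedFormula.rel (L := eqvLang) EqvRel.E) (funext fun k => ?_)⟩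
  fin_cases k
  · exact hi
  · exact hj

theorem isFormulaNumber_iff {n m : ℕ} {v : List ℕ} (hv : v.length = n) :
    isFormulaNumber v m = true ↔ ∃ φ : eqvLang.BoundedFormula Empty n, formulaNumber φ = m := by
  constructor
  · induction m using Nat.strong_induction_on generalizing n v with
    | _ m ih =>
    intro h
    obtain ⟨t, r, rfl⟩ : ∃ t r, m = Nat.pair t r := ⟨_, _, (Nat.pair_unpair m).symm⟩
    have hr : 0 < t → r < Nat.pair t r := fun ht => by
      simpa using unpair_snd_lt (m := Nat.pair t r) (by simpa using ht)
    rw [isFormulaNumber, foldNumber_eq, wfStep] at h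
    simp only [Nat.unpair_pair, children] at h
    split_ifs at h with h₀ h₁ h₂ h₅ h₃ h₄
    · exact ⟨.falsum, by simp_all [formulaNumber]⟩
    · simp only [hv, Bool.and_eq_true] at h
      obtain ⟨i, hi⟩ := exists_termNumber_eq h.1
      obtain ⟨j, hj⟩ := exists_termNumber_eq h.2
      exact ⟨vEq i j, by rw [vEq, formulaNumber, hi, hj, Nat.pair_unpair, h₁]⟩
    · simp only [hv, Bool.and_eq_true, decide_eq_true_eq] at h
      obtain ⟨⟨hr0, hlen⟩, h⟩ := h
      obtain ⟨i, hi⟩ := exists_termNumber_eq h.1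
      obtain ⟨j, hj⟩ := exists_termNumber_eq h.2
      have hargs : Encodable.encode (relArgs (Nat.pair t r)) = r.unpair.2 := by simp [relArgs]
      refine ⟨rE i j, ?_⟩
      obtain ⟨a, b, hab⟩ := List.length_eq_two.1 hlen
      rw [hab] at hi hj hargs
      have h6 : (List.ofFn fun k : Fin 2 => termNumber (L := eqvLang)
          ((![.var (.inr i), .var (.inr j)] : Fin 2 → eqvLang.Term (Empty ⊕ Fin n)) k)) =
          [a, b] := by
        simpa using ⟨hi, hj⟩
      have h7 : formulaNumber (rE i j) = Nat.pair 2 (Nat.pair 0 (Encodable.encode [a, b])) :=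
        h6 ▸ rfl
      rw [h7, hargs, h₂]
      exact congrArg (Nat.pair 2) ((congrArg (fun k => Nat.pair k _) hr0.symm).trans
        (Nat.pair_unpair r))
    · simp only [List.map_cons, List.map_nil, Bool.and_eq_true] at h
      have hl := Nat.unpair_left_le r
      have hr' := Nat.unpair_right_le r
      have := hr (by omega)
      obtain ⟨φ, hφ⟩ := ih _ (by omega) hv h.1
      obtain ⟨ψ, hψ⟩ := ih _ (by omega) hv h.2
      exact ⟨φ.imp ψ, by rw [formulaNumber, hφ, hψ, Nat.pair_unpair, h₃]⟩
    · simp only [List.map_cons, List.map_nil, Bool.and_eq_true] at h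
      obtain ⟨φ, hφ⟩ := ih _ (hr (by omega)) (v := v ++ [0]) (n := n + 1) (by simp [hv]) h.1
      exact ⟨φ.all, by rw [formulaNumber, hφ, h₄]⟩
    · omega
  · rintro ⟨φ, rfl⟩
    induction φ generalizing v with
    | falsum => simp [isFormulaNumber, foldNumber_eq, wfStep, formulaNumber]
    | @equal n t₁ t₂ =>
      obtain ⟨i, rfl⟩ := exists_termNumber n t₁
      obtain ⟨j, rfl⟩ := exists_termNumber n t₂
      simp [isFormulaNumber, foldNumber_eq, wfStep, formulaNumber, hv, isVarNumber_var]
    | @rel n k R ts =>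
      obtain ⟨i, j, h⟩ := exists_rel_eq R ts
      have h0 : (formulaNumber (rE i j)).unpair.1 = 2 := by simp [rE, formulaNumber]
      have h1 : (formulaNumber (rE i j)).unpair.2.unpair.1 = 0 := by
        simp only [rE, formulaNumber, Nat.unpair_pair]; rfl
      rw [h, isFormulaNumber, foldNumber_eq, wfStep, relArgs_formulaNumber, h0, h1]
      simp [isVarNumber, hv]
    | imp φ ψ ih₁ ih₂ =>
      have h₁ := ih₁ hv
      have h₂ := ih₂ hv
      rw [isFormulaNumber] at h₁ h₂ ⊢
      rw [foldNumber_eq, wfStep]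
      simp [formulaNumber, children, h₁, h₂]
    | all φ ih =>
      have h₁ := ih (v := v ++ [0]) (by simp [hv])
      rw [isFormulaNumber] at h₁ ⊢
      rw [foldNumber_eq, wfStep]
      simp [formulaNumber, children, h₁]

/-- Every set of natural numbers is a structure in which `x` and `y` are equivalent if they have the
same first component, as numbers of pairs. -/
instance pairStructure (S : Set ℕ) : eqvLang.Structure S where
  funMap f := Empty.elim f
  RelMap := fun {n} (r : EqvRel n) => match r with
    | .E => fun x => (x 0 : ℕ).unpair.1 = (x 1 : ℕ).unpair.1

theorem realize_vEq {M : Type*} [eqvLang.Structure M] {N : ℕ} {i j : Fin N} {v : Empty → M}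
    {xs : Fin N → M} : (vEq i j).Realize v xs ↔ xs i = xs j :=
  Iff.rfl

/-- The relation that interprets the symbol `E`. -/
def Eqv {M : Type*} [eqvLang.Structure M] (x y : M) : Prop :=
  Structure.RelMap (L := eqvLang) (M := M) EqvRel.E ![x, y]

theorem realize_rE {M : Type*} [eqvLang.Structure M] {N : ℕ} {i j : Fin N} {v : Empty → M}
    {xs : Fin N → M} : (rE i j).Realize v xs ↔ Eqv (xs i) (xs j) := by
  refine iff_of_eq (congrArg (Structure.RelMap (L := eqvLang) EqvRel.E) (funext fun k => ?_))
  fin_cases k <;> rfl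

theorem eqv_pairStructure {S : Set ℕ} {x y : S} :
    Eqv x y ↔ (x : ℕ).unpair.1 = (y : ℕ).unpair.1 :=
  Iff.rfl

theorem getD_ofFn {n : ℕ} (f : Fin n → ℕ) (i : Fin n) : (List.ofFn f).getD i 0 = f i := by
  simp [List.getD]

/-- The recursion `evalNumber` computes truth in the finite structure with universe `D`. -/
theorem evalNumber_iff (D : List ℕ) {n : ℕ} (φ : eqvLang.BoundedFormula Empty n)
    (xs : Fin n → {x | x ∈ D}) :
    evalNumber D (List.ofFn fun i => (xs i : ℕ)) (formulaNumber φ) = true ↔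
      φ.Realize default xs := by
  induction φ with
  | falsum => simp [evalNumber, foldNumber_eq, evalStep, formulaNumber, BoundedFormula.Realize]
  | @equal n t₁ t₂ =>
    obtain ⟨i, rfl⟩ := exists_termNumber n t₁
    obtain ⟨j, rfl⟩ := exists_termNumber n t₂
    rw [← vEq, realize_vEq, evalNumber, foldNumber_eq, evalStep, vEq]
    simp only [formulaNumber, termNumber, Nat.unpair_pair, getD_ofFn]
    simp [Subtype.ext_iff]
  | @rel n k R ts =>
    obtain ⟨i, j, h⟩ := exists_rel_eq R ts
    have h0 : (formulaNumber (rE i j)).unpair.1 = 2 := by simp [rE, formulaNumber]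
    rw [h, realize_rE, eqv_pairStructure, evalNumber, foldNumber_eq, evalStep,
      relArgs_formulaNumber, h0]
    simp only [List.getD_cons_zero, List.getD_cons_succ, Nat.unpair_pair, getD_ofFn]
    simp
  | imp φ ψ ih₁ ih₂ =>
    rw [BoundedFormula.realize_imp, ← ih₁, ← ih₂]
    simp only [evalNumber]
    rw [foldNumber_eq, evalStep]
    simp only [formulaNumber, children, Nat.unpair_pair]
    simp [imp_iff_not_or]
  | @all n φ ih =>
    rw [BoundedFormula.realize_all, evalNumber, foldNumber_eq, evalStep]
    simp only [formulaNumber, children, Nat.unpair_pair]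
    have key : ∀ a : {x | x ∈ D}, foldNumber evalStep
        (D, (List.ofFn fun i => (xs i : ℕ)) ++ [(a : ℕ)], formulaNumber φ) = true ↔
          φ.Realize default (Fin.snoc xs a) := by
      intro a
      rw [← ih, evalNumber]
      have : (List.ofFn fun i => ((Fin.snoc xs a : Fin (n + 1) → {x | x ∈ D}) i : ℕ)) =
          (List.ofFn fun i => (xs i : ℕ)) ++ [(a : ℕ)] := by
        rw [List.ofFn_succ']
        simp
      rw [this]
    simp only [← key]
    simp

/-! ### Back and forth between equivalence relations -/

section BackAndForth

variable {M N : Type*} [eqvLang.Structure M] [eqvLang.Structure N] {q : ℕ}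

/-- The set of the elements that are equivalent to `x`. -/
def eqvClass (x : M) : Set M :=
  {y | Eqv x y}

/-- `M` satisfies the part of Janiczak's theory that matters for formulas with at most `q` variables
and quantifiers: `E` is an equivalence relation, for every `k < q` there is at most one class of
size `k`, and at least `q` classes have at least `q` elements. -/
structure IsJaniczak (q : ℕ) (M : Type*) [eqvLang.Structure M] : Prop where
  equivalence : Equivalence (Eqv (M := M))
  unique : ∀ k < q, ∀ x y : M, (eqvClass x).encard = k → (eqvClass y).encard = k → Eqv x y
  many : ∃ f : Fin q → M, (∀ i j, Eqv (f i) (f j) → i = j) ∧ ∀ i, q ≤ (eqvClass (f i)).encard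

/-- The classes of `x` and `y` have the same size, where sizes from `q` on are not distinguished. -/
def SameSize (q : ℕ) (x : M) (y : N) : Prop :=
  ∀ k < q, (eqvClass x).encard = k ↔ (eqvClass y).encard = k

/-- The same sizes below `q` are sizes of classes of `M` and of `N`. -/
def SamePattern (q : ℕ) (M N : Type*) [eqvLang.Structure M] [eqvLang.Structure N] : Prop :=
  ∀ k < q, (∃ x : M, (eqvClass x).encard = k) ↔ ∃ y : N, (eqvClass y).encard = k

/-- The tuples `a` and `b` satisfy the same atomic formulas, and corresponding entries have classes
of the same size, where sizes from `q` on are not distinguished. -/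
structure Similar {ι : Type*} (q : ℕ) (a : ι → M) (b : ι → N) : Prop where
  eq : ∀ i j, a i = a j ↔ b i = b j
  eqv : ∀ i j, Eqv (a i) (a j) ↔ Eqv (b i) (b j)
  size : ∀ i, SameSize q (a i) (b i)

theorem Similar.symm {ι : Type*} {a : ι → M} {b : ι → N} (h : Similar q a b) : Similar q b a :=
  ⟨fun i j => (h.eq i j).symm, fun i j => (h.eqv i j).symm, fun i k hk => (h.size i k hk).symm⟩

theorem IsJaniczak.eqvClass_eq (hM : IsJaniczak q M) {x y : M} (h : Eqv x y) :
    eqvClass x = eqvClass y :=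
  Set.ext fun _ => ⟨fun h' => hM.equivalence.trans (hM.equivalence.symm h) h',
    fun h' => hM.equivalence.trans h h'⟩

theorem encard_image_le_of_eq_iff {ι X Y : Type*} {a : ι → X} {b : ι → Y}
    (h : ∀ i j, a i = a j ↔ b i = b j) (J : Set ι) : (b '' J).encard ≤ (a '' J).encard := by
  classical
  rcases J.eq_empty_or_nonempty with rfl | ⟨j₀, -⟩
  · simp
  have : Nonempty ι := ⟨j₀⟩
  refine Set.encard_le_encard_of_injOn (f := fun y => a (Function.invFunOn b J y)) ?_ ?_
  · rintro _ ⟨j, hj, rfl⟩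
    exact ⟨_, Function.invFunOn_mem ⟨j, hj, rfl⟩, rfl⟩
  · rintro _ ⟨j, hj, rfl⟩ _ ⟨j', hj', rfl⟩ h'
    have h'' := (h _ _).1 h'
    have e : ∀ i ∈ J, b (Function.invFunOn b J (b i)) = b i := fun i hi =>
      Function.invFunOn_eq ⟨i, hi, rfl⟩
    rwa [e j hj, e j' hj'] at h''

/-- The extension step of the back-and-forth argument. -/
theorem Similar.exists_extension {ι : Type*} [Finite ι] {a : ι → M} {b : ι → N}
    (hM : IsJaniczak q M) (hN : IsJaniczak q N) (hMN : SamePattern q M N)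
    (h : Similar q a b) (hq : Nat.card ι < q) (x : M) :
    ∃ y : N, (∀ i, a i = x ↔ b i = y) ∧ (∀ i, Eqv (a i) x ↔ Eqv (b i) y) ∧ SameSize q x y := by
  classical
  by_cases h₁ : ∃ i, a i = x
  · obtain ⟨i, rfl⟩ := h₁
    exact ⟨b i, fun j => h.eq j i, fun j => h.eqv j i, h.size i⟩
  by_cases h₂ : ∃ i, Eqv (a i) x
  · obtain ⟨i, hi⟩ := h₂
    -- Otherwise the class of `b i` has fewer than `q` elements, so the class of `a i` has the same
    -- size, and it is exhausted by entries of `a` as well.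
    have : ¬ eqvClass (b i) ⊆ Set.range b := by
      intro hsub
      set J : Set ι := {j | Eqv (b i) (b j)} with hJ
      have hbJ : eqvClass (b i) = b '' J := by
        ext y
        constructor
        · intro hy
          obtain ⟨j, rfl⟩ := hsub hy
          exact ⟨j, hy, rfl⟩
        · rintro ⟨j, hj, rfl⟩
          exact hj
      have hfin : (b '' J).Finite := Set.toFinite _
      have hcard : (b '' J).ncard < q :=
        lt_of_le_of_lt ((Set.ncard_image_le (Set.toFinite J)).trans
          ((Set.ncard_le_ncard (Set.subset_univ J)).trans (Set.ncard_univ ι).le)) hq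
      have h₃ := (h.size i _ hcard).2 (by rw [hbJ, hfin.cast_ncard_eq])
      have h₄ : a '' J ⊆ eqvClass (a i) := by
        rintro _ ⟨j, hj, rfl⟩
        exact (h.eqv i j).2 hj
      have h₅ : (eqvClass (a i)).encard ≤ (a '' J).encard := by
        rw [h₃, hfin.cast_ncard_eq]
        exact encard_image_le_of_eq_iff h.eq J
      have h₆ := (Set.toFinite (a '' J)).eq_of_subset_of_encard_le h₄ h₅
      obtain ⟨j, -, hj⟩ := (h₆ ▸ hi : x ∈ a '' J)
      exact h₁ ⟨j, hj⟩
    obtain ⟨y, hy, hy'⟩ := Set.not_subset.1 this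
    refine ⟨y, fun j => ⟨fun hj => absurd ⟨j, hj⟩ h₁, fun hj => absurd ⟨j, hj⟩ hy'⟩,
      fun j => ⟨fun hj => ?_, fun hj => ?_⟩, ?_⟩
    · exact hN.equivalence.trans ((h.eqv j i).1
        (hM.equivalence.trans hj (hM.equivalence.symm hi))) hy
    · exact hM.equivalence.trans ((h.eqv j i).2
        (hN.equivalence.trans hj (hN.equivalence.symm hy))) hi
    · intro k hk
      rw [← hM.eqvClass_eq hi, ← hN.eqvClass_eq hy]
      exact h.size i k hk
  push Not at h₁ h₂
  -- It remains to find an element of a class of the right size that does not meet the range of `b`.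
  suffices ∃ y : N, (∀ i, ¬ Eqv (b i) y) ∧ SameSize q x y by
    obtain ⟨y, hy, hy'⟩ := this
    exact ⟨y, fun i => ⟨fun hi => absurd hi (h₁ i), fun hi => absurd
      (hi ▸ hN.equivalence.refl (b i)) (hy i)⟩, fun i => ⟨fun hi => absurd hi (h₂ i),
      fun hi => absurd hi (hy i)⟩, hy'⟩
  by_cases h₃ : ∃ k < q, (eqvClass x).encard = k
  · obtain ⟨k, hk, hxk⟩ := h₃
    obtain ⟨y, hy⟩ := (hMN k hk).1 ⟨x, hxk⟩
    refine ⟨y, fun i hi => h₂ i ?_, fun k' _ => by rw [hxk, hy]⟩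
    exact hM.unique k hk _ _ ((h.size i k hk).2 (by rw [hN.eqvClass_eq hi, hy])) hxk
  · push Not at h₃
    obtain ⟨f, hf, hf'⟩ := hN.many
    have : ∃ j, ∀ i, ¬ Eqv (b i) (f j) := by
      by_contra hcon
      push Not at hcon
      choose g hg using hcon
      have hinj : Function.Injective g := fun j j' hjj' => hf j j'
        (hN.equivalence.trans (hN.equivalence.symm (hg j)) (hjj' ▸ hg j'))
      have := Nat.card_le_card_of_injective g hinj
      rw [Nat.card_fin] at this
      omega
    obtain ⟨j, hj⟩ := this
    refine ⟨f j, hj, fun k hk => iff_of_false (h₃ k hk) fun h' => ?_⟩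
    have := hf' j
    rw [h', Nat.cast_le] at this
    omega

theorem exists_eq_var {β : Type*} (t : eqvLang.Term β) : ∃ i, t = .var i := by
  rcases t with i | f
  · exact ⟨i, rfl⟩
  · exact Empty.elim f

theorem realize_rel_iff {α : Type*} {n : ℕ} {ts : Fin 2 → eqvLang.Term (α ⊕ Fin n)}
    {i j : α ⊕ Fin n} (hi : ts 0 = .var i) (hj : ts 1 = .var j) {v : α → M} {xs : Fin n → M} :
    (BoundedFormula.rel (L := eqvLang) EqvRel.E ts).Realize v xs ↔
      Eqv (Sum.elim v xs i) (Sum.elim v xs j) := by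
  refine iff_of_eq (congrArg (Structure.RelMap (L := eqvLang) EqvRel.E) (funext fun k => ?_))
  fin_cases k
  · exact congrArg (Term.realize _) hi
  · exact congrArg (Term.realize _) hj

/-- The quantifier depth of a formula. -/
def depth {α : Type*} : {n : ℕ} → eqvLang.BoundedFormula α n → ℕ
  | _, .falsum => 0
  | _, .equal _ _ => 0
  | _, .rel _ _ => 0
  | _, .imp φ ψ => max (depth φ) (depth ψ)
  | _, .all φ => depth φ + 1

/-- The result of an extension step is again a pair of similar tuples. -/
theorem Similar.snoc {α : Type*} {n : ℕ} {v : α → M} {w : α → N} {xs : Fin n → M} {ys : Fin n → N}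
    (hM : IsJaniczak q M) (hN : IsJaniczak q N)
    (h : Similar q (Sum.elim v xs) (Sum.elim w ys)) {x : M} {y : N}
    (h₁ : ∀ i, Sum.elim v xs i = x ↔ Sum.elim w ys i = y)
    (h₂ : ∀ i, Eqv (Sum.elim v xs i) x ↔ Eqv (Sum.elim w ys i) y) (h₃ : SameSize q x y) :
    Similar q (Sum.elim v (Fin.snoc xs x : Fin (n + 1) → M))
      (Sum.elim w (Fin.snoc ys y : Fin (n + 1) → N)) := by
  have key : ∀ i : α ⊕ Fin (n + 1), (∃ j : α ⊕ Fin n,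
      Sum.elim v (Fin.snoc xs x : Fin (n + 1) → M) i = Sum.elim v xs j ∧
        Sum.elim w (Fin.snoc ys y : Fin (n + 1) → N) i = Sum.elim w ys j) ∨
      Sum.elim v (Fin.snoc xs x : Fin (n + 1) → M) i = x ∧
        Sum.elim w (Fin.snoc ys y : Fin (n + 1) → N) i = y := by
    rintro (i | i)
    · exact .inl ⟨.inl i, rfl, rfl⟩
    · refine Fin.lastCases (.inr (by simp)) (fun i => .inl ⟨.inr i, by simp⟩) i
  refine ⟨fun i j => ?_, fun i j => ?_, fun i => ?_⟩
  · rcases key i with ⟨i', e₁, e₂⟩ | ⟨e₁, e₂⟩ <;> rcases key j with ⟨j', e₃, e₄⟩ | ⟨e₃, e₄⟩ <;>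
      rw [e₁, e₂, e₃, e₄]
    · exact h.eq i' j'
    · exact h₁ i'
    · rw [eq_comm, h₁ j', eq_comm]
    · exact iff_of_true rfl rfl
  · rcases key i with ⟨i', e₁, e₂⟩ | ⟨e₁, e₂⟩ <;> rcases key j with ⟨j', e₃, e₄⟩ | ⟨e₃, e₄⟩ <;>
      rw [e₁, e₂, e₃, e₄]
    · exact h.eqv i' j'
    · exact h₂ i'
    · exact ⟨fun h' => hN.equivalence.symm ((h₂ j').1 (hM.equivalence.symm h')),
        fun h' => hM.equivalence.symm ((h₂ j').2 (hN.equivalence.symm h'))⟩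
    · exact iff_of_true (hM.equivalence.refl x) (hN.equivalence.refl y)
  · rcases key i with ⟨i', e₁, e₂⟩ | ⟨e₁, e₂⟩ <;> rw [e₁, e₂]
    · exact h.size i'
    · exact h₃

/-- Similar tuples satisfy the same formulas of small quantifier depth. -/
theorem Similar.realize_iff {α : Type*} [Finite α] (hM : IsJaniczak q M) (hN : IsJaniczak q N)
    (hMN : SamePattern q M N) {n : ℕ} (φ : eqvLang.BoundedFormula α n) {v : α → M} {w : α → N}
    {xs : Fin n → M} {ys : Fin n → N} (h : Similar q (Sum.elim v xs) (Sum.elim w ys))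
    (hq : Nat.card α + n + depth φ ≤ q) : φ.Realize v xs ↔ φ.Realize w ys := by
  induction φ with
  | falsum => exact Iff.rfl
  | equal t₁ t₂ =>
    obtain ⟨i, rfl⟩ := exists_eq_var t₁
    obtain ⟨j, rfl⟩ := exists_eq_var t₂
    exact h.eq i j
  | rel R ts =>
    cases R
    obtain ⟨i, hi⟩ := exists_eq_var (ts 0)
    obtain ⟨j, hj⟩ := exists_eq_var (ts 1)
    exact (realize_rel_iff hi hj).trans ((h.eqv i j).trans (realize_rel_iff hi hj).symm)
  | imp φ ψ ih₁ ih₂ =>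
    rw [depth] at hq
    rw [BoundedFormula.realize_imp, BoundedFormula.realize_imp, ih₁ h (by omega),
      ih₂ h (by omega)]
  | @all n φ ih =>
    rw [depth] at hq
    rw [BoundedFormula.realize_all, BoundedFormula.realize_all]
    have hcard : Nat.card (α ⊕ Fin n) < q := by
      rw [Nat.card_sum, Nat.card_fin]
      omega
    constructor
    · intro h' y
      obtain ⟨x, h₁, h₂, h₃⟩ := h.symm.exists_extension hN hM (fun k hk => (hMN k hk).symm) hcard y
      exact (ih (h.snoc hM hN (fun i => (h₁ i).symm) (fun i => (h₂ i).symm)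
        fun k hk => (h₃ k hk).symm) (by omega)).1 (h' x)
    · intro h' x
      obtain ⟨y, h₁, h₂, h₃⟩ := h.exists_extension hM hN hMN hcard x
      exact (ih (h.snoc hM hN h₁ h₂ h₃) (by omega)).2 (h' y)

/-- A Gödel number bounds the quantifier depth, so that no computation of the depth is needed. -/
theorem depth_le_formulaNumber {n : ℕ} (φ : eqvLang.BoundedFormula Empty n) :
    depth φ ≤ formulaNumber φ := by
  induction φ with
  | falsum => simp [depth]
  | equal => simp [depth]
  | rel => simp [depth]
  | imp φ ψ ih₁ ih₂ =>
    have h₁ := Nat.right_le_pair 3 (Nat.pair (formulaNumber φ) (formulaNumber ψ))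
    have h₂ := Nat.right_le_pair (formulaNumber φ) (formulaNumber ψ)
    have h₃ := Nat.left_le_pair (formulaNumber φ) (formulaNumber ψ)
    rw [depth, formulaNumber]
    omega
  | all φ ih =>
    have h₁ := Nat.add_le_pair 4 (formulaNumber φ)
    rw [depth, formulaNumber]
    omega

/-- Structures that satisfy a large part of Janiczak's theory, and whose classes have the same sizes
below a large number, satisfy the same sentences of small Gödel number. -/
theorem realize_sentence_iff (hM : IsJaniczak q M) (hN : IsJaniczak q N)
    (hMN : SamePattern q M N) (φ : eqvLang.Sentence) (hq : sentenceNumber φ ≤ q) :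
    M ⊨ φ ↔ N ⊨ φ := by
  refine Similar.realize_iff hM hN hMN φ ?_ ?_
  · refine ⟨?_, ?_, ?_⟩ <;> rintro (i | i) <;> first | exact i.elim | exact i.elim0
  · have := depth_le_formulaNumber φ
    rw [sentenceNumber] at hq
    simp only [Nat.card_eq_fintype_card, Fintype.card_empty]
    omega

end BackAndForth

/-! ### Models of Janiczak's theory -/

section Semantics

variable {M : Type*} [eqvLang.Structure M] {N : ℕ} {v : Empty → M} {xs : Fin N → M}

theorem realize_conj {L : FirstOrder.Language.{0, 0}} {M : Type*} [L.Structure M] {n : ℕ}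
    {l : List (L.BoundedFormula Empty n)} {v : Empty → M} {xs : Fin n → M} :
    (conj l).Realize v xs ↔ ∀ φ ∈ l, φ.Realize v xs :=
  BoundedFormula.realize_foldr_inf l v xs

theorem realize_disj {L : FirstOrder.Language.{0, 0}} {M : Type*} [L.Structure M] {n : ℕ}
    {l : List (L.BoundedFormula Empty n)} {v : Empty → M} {xs : Fin n → M} :
    (disj l).Realize v xs ↔ ∃ φ ∈ l, φ.Realize v xs :=
  BoundedFormula.realize_foldr_sup l v xs

theorem realize_pairwiseNe {k : ℕ} {f : Fin k → Fin N} :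
    (pairwiseNe f).Realize v xs ↔ Function.Injective fun i => xs (f i) := by
  simp only [pairwiseNe, realize_conj, List.mem_map, List.mem_finRange, true_and,
    forall_exists_index, forall_apply_eq_imp_iff, List.mem_filter, decide_eq_true_eq, and_imp,
    forall_apply_eq_imp_iff₂, BoundedFormula.realize_not, realize_vEq]
  constructor
  · intro h i j hij
    by_contra hne
    rcases lt_or_gt_of_ne hne with h' | h'
    · exact h i j h' hij
    · exact h j i h' hij.symm
  · intro h i j hij h'
    exact hij.ne (h h')

theorem realize_pairwiseE {k : ℕ} {f : Fin k → Fin N} :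
    (pairwiseE f).Realize v xs ↔ ∀ i j, Eqv (xs (f i)) (xs (f j)) := by
  simp only [pairwiseE, realize_conj, List.mem_map, List.mem_finRange, true_and,
    forall_exists_index, forall_apply_eq_imp_iff, realize_rE]

theorem realize_isClass (hM : Equivalence (Eqv (M := M))) {k : ℕ} {f : Fin (k + 1) → Fin N} :
    (isClass f).Realize v xs ↔ (Function.Injective fun i => xs (f i)) ∧
      eqvClass (xs (f 0)) = Set.range fun i => xs (f i) := by
  have : (isClass f).Realize v xs ↔ ((Function.Injective fun i => xs (f i)) ∧
      ∀ i j, Eqv (xs (f i)) (xs (f j))) ∧ ∀ a, Eqv (xs (f 0)) a → ∃ i, a = xs (f i) := by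
    simp only [isClass, BoundedFormula.realize_inf, realize_pairwiseNe, realize_pairwiseE,
      BoundedFormula.realize_all, BoundedFormula.realize_imp, realize_rE, realize_disj,
      List.mem_map, List.mem_finRange, true_and, exists_exists_eq_and, realize_vEq,
      Fin.snoc_castSucc, Fin.snoc_last]
  rw [this]
  constructor
  · rintro ⟨⟨h₁, h₂⟩, h₃⟩
    refine ⟨h₁, Set.ext fun a => ⟨fun ha => ?_, ?_⟩⟩
    · obtain ⟨i, rfl⟩ := h₃ a ha
      exact ⟨i, rfl⟩
    · rintro ⟨i, rfl⟩
      exact h₂ 0 i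
  · rintro ⟨h₁, h₂⟩
    have h₃ : ∀ i, Eqv (xs (f 0)) (xs (f i)) := fun i =>
      (h₂ ▸ Set.mem_range_self i : xs (f i) ∈ eqvClass (xs (f 0)))
    refine ⟨⟨h₁, fun i j => hM.trans (hM.symm (h₃ i)) (h₃ j)⟩, fun a ha => ?_⟩
    obtain ⟨i, hi⟩ := (h₂ ▸ ha : a ∈ Set.range fun i => xs (f i))
    exact ⟨i, hi.symm⟩

theorem encard_range_fin {α : Type*} {k : ℕ} {g : Fin k → α} (hg : Function.Injective g) :
    (Set.range g).encard = k := by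
  rw [← Set.image_univ, hg.encard_image, Set.encard_univ]
  simp

/-- An enumeration of a class of size `k + 1` without repetition, in the form of `isClass`. -/
theorem exists_enumeration {k : ℕ} {x : M} (hM : Equivalence (Eqv (M := M)))
    (hx : (eqvClass x).encard = (k + 1 : ℕ)) : ∃ g : Fin (k + 1) → M, Function.Injective g ∧
      eqvClass (g 0) = Set.range g ∧ Eqv x (g 0) := by
  have hfin : (eqvClass x).Finite := Set.finite_of_encard_eq_coe hx
  have := hfin.to_subtype
  have hcard : Nat.card (eqvClass x) = k + 1 := by
    rw [Nat.card_coe_set_eq, Set.ncard, hx, ENat.toNat_natCast]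
  let g := (Finite.equivFinOfCardEq hcard).symm
  have hg : Set.range (fun i => (g i : M)) = eqvClass x := by
    ext y
    refine ⟨?_, fun hy => ⟨g.symm ⟨y, hy⟩, by simp⟩⟩
    rintro ⟨i, rfl⟩
    exact (g i).2
  refine ⟨fun i => g i, fun i j hij => g.injective (Subtype.ext hij), ?_, (g 0).2⟩
  rw [hg]
  exact Set.ext fun y => ⟨fun hy => hM.trans (g 0).2 hy,
    fun hy => hM.trans (hM.symm (g 0).2) hy⟩

theorem realize_sentenceA (hM : Equivalence (Eqv (M := M))) {n : ℕ} :
    M ⊨ sentenceA n ↔ ∃ x : M, (eqvClass x).encard = (n + 1 : ℕ) := by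
  refine BoundedFormula.realize_exs.trans ⟨?_, ?_⟩
  · rintro ⟨xs, h⟩
    obtain ⟨h₁, h₂⟩ := (realize_isClass hM).1 h
    exact ⟨_, h₂ ▸ encard_range_fin h₁⟩
  · rintro ⟨x, hx⟩
    obtain ⟨g, h₁, h₂, -⟩ := exists_enumeration hM hx
    exact ⟨g, (realize_isClass hM).2 ⟨h₁, h₂⟩⟩

theorem realize_axUnique (hM : Equivalence (Eqv (M := M))) {k : ℕ} :
    M ⊨ axUnique k ↔ ∀ x y : M, (eqvClass x).encard = (k + 1 : ℕ) →
      (eqvClass y).encard = (k + 1 : ℕ) → Eqv x y := by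
  refine BoundedFormula.realize_alls.trans ⟨fun h x y hx hy => ?_, fun h xs => ?_⟩
  · obtain ⟨g, h₁, h₂, h₃⟩ := exists_enumeration hM hx
    obtain ⟨g', h₁', h₂', h₃'⟩ := exists_enumeration hM hy
    have := h (Fin.append g g')
    simp only [BoundedFormula.realize_imp, realize_isClass hM, realize_rE, Fin.append_left,
      Fin.append_right] at this
    exact hM.trans h₃ (hM.trans (this ⟨h₁, h₂⟩ ⟨h₁', h₂'⟩) (hM.symm h₃'))
  · simp only [BoundedFormula.realize_imp, realize_isClass hM, realize_rE]
    rintro ⟨h₁, h₂⟩ ⟨h₃, h₄⟩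
    exact h _ _ (h₂ ▸ encard_range_fin h₁) (h₄ ▸ encard_range_fin h₃)

theorem realize_axMany (hM : Equivalence (Eqv (M := M))) {n : ℕ} :
    M ⊨ axMany n ↔ ∃ f : Fin n → M, (∀ i j, Eqv (f i) (f j) → i = j) ∧
      ∀ i, n ≤ (eqvClass (f i)).encard := by
  refine BoundedFormula.realize_exs.trans ?_
  simp only [BoundedFormula.realize_inf, realize_conj, List.mem_map, List.mem_finRange, true_and,
    forall_exists_index, forall_apply_eq_imp_iff, List.mem_filter, decide_eq_true_eq, and_imp,
    forall_apply_eq_imp_iff₂, BoundedFormula.realize_not, realize_pairwiseNe, realize_pairwiseE,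
    realize_rE]
  constructor
  · rintro ⟨xs, h₁, h₂⟩
    rcases Nat.eq_zero_or_pos n with rfl | hn
    · exact ⟨Fin.elim0, fun i => i.elim0, fun i => i.elim0⟩
    refine ⟨fun i => xs (finProdFinEquiv (i, ⟨0, hn⟩)), fun i j hij => ?_, fun i => ?_⟩
    · by_contra hne
      rcases lt_or_gt_of_ne hne with h' | h'
      · exact h₂ i j h' _ _ hij
      · exact h₂ j i h' _ _ (hM.symm hij)
    · rw [← encard_range_fin (h₁ i).1]
      refine Set.encard_le_encard ?_
      rintro _ ⟨j, rfl⟩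
      exact (h₁ i).2 _ _
  · rintro ⟨f, h₁, h₂⟩
    have : ∀ i, ∃ g : Fin n → M, Function.Injective g ∧ ∀ j, Eqv (f i) (g j) := by
      intro i
      obtain ⟨t, ht, htn⟩ := Set.exists_subset_encard_eq (h₂ i)
      have hfin : t.Finite := Set.finite_of_encard_eq_coe htn
      have := hfin.to_subtype
      have hcard : Nat.card t = n := by
        rw [Nat.card_coe_set_eq, Set.ncard, htn, ENat.toNat_natCast]
      let g := (Finite.equivFinOfCardEq hcard).symm
      exact ⟨fun j => g j, fun j j' hjj' => g.injective (Subtype.ext hjj'), fun j => ht (g j).2⟩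
    choose g hg hg' using this
    refine ⟨fun k => g (finProdFinEquiv.symm k).1 (finProdFinEquiv.symm k).2, fun i => ?_,
      fun i i' hii' j j' h => ?_⟩
    · simp only [Equiv.symm_apply_apply]
      exact ⟨hg i, fun j j' => hM.trans (hM.symm (hg' i j)) (hg' i j')⟩
    · simp only [Equiv.symm_apply_apply] at h
      exact hii'.ne (h₁ i i' (hM.trans (hg' i j) (hM.trans h (hM.symm (hg' i' j')))))

theorem realize_equivalence :
    (M ⊨ axRefl ∧ M ⊨ axSymm ∧ M ⊨ axTrans) ↔ Equivalence (Eqv (M := M)) := by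
  have h₁ : M ⊨ axRefl ↔ ∀ x : M, Eqv x x := by
    refine BoundedFormula.realize_alls.trans ?_
    simp only [realize_rE]
    exact ⟨fun h x => h fun _ => x, fun h xs => h _⟩
  have h₂ : M ⊨ axSymm ↔ ∀ x y : M, Eqv x y → Eqv y x := by
    refine BoundedFormula.realize_alls.trans ?_
    simp only [BoundedFormula.realize_imp, realize_rE]
    exact ⟨fun h x y => h ![x, y], fun h xs => h _ _⟩
  have h₃ : M ⊨ axTrans ↔ ∀ x y z : M, Eqv x y → Eqv y z → Eqv x z := by
    refine BoundedFormula.realize_alls.trans ?_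
    simp only [BoundedFormula.realize_imp, realize_rE]
    exact ⟨fun h x y z => h ![x, y, z], fun h xs => h _ _ _⟩
  rw [h₁, h₂, h₃]
  exact ⟨fun h => ⟨h.1, h.2.1 _ _, h.2.2 _ _ _⟩,
    fun h => ⟨h.refl, fun _ _ => h.symm, fun _ _ _ => h.trans⟩⟩

/-- The models of Janiczak's theory, in semantic terms. -/
theorem model_theoryJ_iff : M ⊨ theoryJ ↔ ∀ q, IsJaniczak q M := by
  rw [Theory.model_iff]
  constructor
  · intro h q
    have hM := realize_equivalence.1 ⟨h axRefl (.inl rfl), h axSymm (.inr (.inl rfl)),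
      h axTrans (.inr (.inr (.inl rfl)))⟩
    refine ⟨hM, fun k _ x y hx hy => ?_,
      (realize_axMany hM).1 (h _ (.inr (.inr (.inr (.inr ⟨q, rfl⟩)))))⟩
    rcases k with _ | k
    · rw [Nat.cast_zero, Set.encard_eq_zero] at hx
      exact (Set.notMem_empty x (hx ▸ hM.refl x : x ∈ (∅ : Set M))).elim
    · exact (realize_axUnique hM).1 (h _ (.inr (.inr (.inr (.inl ⟨k, rfl⟩))))) x y hx hy
  · intro h φ hφ
    have hM := (h 0).equivalence
    have hE := realize_equivalence.2 hM
    rcases hφ with rfl | rfl | rfl | ⟨k, rfl⟩ | ⟨n, rfl⟩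
    · exact hE.1
    · exact hE.2.1
    · exact hE.2.2
    · exact (realize_axUnique hM).2 fun x y => (h (k + 2)).unique (k + 1) (by omega) x y
    · exact (realize_axMany hM).2 (h n).many

theorem samePattern_iff {q : ℕ} {M N : Type*} [eqvLang.Structure M] [eqvLang.Structure N]
    (hM : Equivalence (Eqv (M := M))) (hN : Equivalence (Eqv (M := N))) :
    SamePattern q M N ↔ ∀ n, n + 1 < q → (M ⊨ sentenceA n ↔ N ⊨ sentenceA n) := by
  constructor
  · intro h n hn
    rw [realize_sentenceA hM, realize_sentenceA hN]
    exact h (n + 1) hn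
  · intro h k hk
    rcases k with _ | n
    · simp only [Nat.cast_zero, Set.encard_eq_zero]
      exact iff_of_false (fun ⟨x, hx⟩ => Set.notMem_empty x (hx ▸ hM.refl x : x ∈ (∅ : Set M)))
        fun ⟨x, hx⟩ => Set.notMem_empty x (hx ▸ hN.refl x : x ∈ (∅ : Set N))
    · have := h n hk
      rwa [realize_sentenceA hM, realize_sentenceA hN] at this

end Semantics

/-! ### Structures with prescribed class sizes -/

/-- The set of numbers of pairs in which the class of the pairs with first component `k` has size
`s k`. -/
def sizedSet (s : ℕ → ℕ∞) : Set ℕ :=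
  {x | (x.unpair.2 : ℕ∞) < s x.unpair.1}

section SizedSet

variable {s : ℕ → ℕ∞} {q : ℕ}

theorem equivalence_pairStructure (S : Set ℕ) : Equivalence (Eqv (M := S)) :=
  ⟨fun _ => rfl, fun h => Eq.symm h, fun h₁ h₂ => Eq.trans h₁ h₂⟩

theorem encard_setOf_coe_lt (t : ℕ∞) : {j : ℕ | (j : ℕ∞) < t}.encard = t := by
  induction t using ENat.recTopCoe with
  | top => simp
  | coe n =>
    have : {j : ℕ | (j : ℕ∞) < n} = (Finset.range n : Set ℕ) := by
      ext
      simp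
    rw [this, Set.encard_coe_eq_coe_finsetCard, Finset.card_range]

theorem encard_eqvClass (x : sizedSet s) : (eqvClass x).encard = s (x : ℕ).unpair.1 := by
  rw [← encard_setOf_coe_lt (s (x : ℕ).unpair.1)]
  have h : ∀ y ∈ eqvClass x, (y : ℕ).unpair.1 = (x : ℕ).unpair.1 := fun y hy => Eq.symm hy
  have himage : (fun y : sizedSet s => (y : ℕ).unpair.2) '' eqvClass x =
      {j : ℕ | (j : ℕ∞) < s (x : ℕ).unpair.1} := by
    ext j
    constructor
    · rintro ⟨y, hy, rfl⟩
      have : ((y : ℕ).unpair.2 : ℕ∞) < s (y : ℕ).unpair.1 := y.2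
      rwa [h y hy] at this
    · intro hj
      exact ⟨⟨Nat.pair (x : ℕ).unpair.1 j, by simpa [sizedSet] using hj⟩,
        by simp [eqvClass, eqv_pairStructure], by simp⟩
  rw [← himage]
  refine (Set.InjOn.encard_image fun y hy z hz hyz => Subtype.ext ?_).symm
  rw [← Nat.pair_unpair (y : ℕ), ← Nat.pair_unpair (z : ℕ), h y hy, h z hz]
  exact congrArg _ hyz

/-- The size functions in which the class with number `2 * k` is empty or has size `k + 1`, and in
which the classes with odd numbers are large or empty. -/
structure IsJaniczakSize (q : ℕ) (s : ℕ → ℕ∞) : Prop where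
  even : ∀ k, s (2 * k) = 0 ∨ s (2 * k) = (k + 1 : ℕ)
  odd : ∀ k, s (2 * k + 1) = 0 ∨ q ≤ s (2 * k + 1)
  many : ∀ k < q, q ≤ s (2 * k + 1)

/-- The classes of size `k < q` are those with an even number, of which only one has size `k`. -/
theorem IsJaniczakSize.unpair_fst (hs : IsJaniczakSize q s) {k : ℕ} (hk : k < q) {x : sizedSet s}
    (hx : (eqvClass x).encard = k) : ∃ n, k = n + 1 ∧ (x : ℕ).unpair.1 = 2 * n := by
  have hpos : s (x : ℕ).unpair.1 ≠ 0 := fun h => by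
    have : ((x : ℕ).unpair.2 : ℕ∞) < s (x : ℕ).unpair.1 := x.2
    rw [h] at this
    exact not_lt_bot this
  rw [encard_eqvClass] at hx
  obtain ⟨n, hn | hn⟩ := Nat.even_or_odd' (x : ℕ).unpair.1
  · rw [hn] at hx hpos
    exact ⟨n, Nat.cast_injective (R := ℕ∞) (hx.symm.trans ((hs.even n).resolve_left hpos)), hn⟩
  · rw [hn] at hx hpos
    have := (hs.odd n).resolve_left hpos
    rw [hx, Nat.cast_le] at this
    omega

theorem IsJaniczakSize.isJaniczak (hs : IsJaniczakSize q s) : IsJaniczak q (sizedSet s) := by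
  refine ⟨equivalence_pairStructure _, fun k hk x y hx hy => ?_,
    fun i => ⟨Nat.pair (2 * i + 1) 0, ?_⟩, fun i j hij => ?_, fun i => ?_⟩
  · obtain ⟨n, hn, hxn⟩ := hs.unpair_fst hk hx
    obtain ⟨n', hn', hyn⟩ := hs.unpair_fst hk hy
    rw [eqv_pairStructure, hxn, hyn]
    omega
  · simp only [sizedSet, Set.mem_ofPred_eq, Nat.unpair_pair]
    exact lt_of_lt_of_le (Nat.cast_lt.2 (lt_of_le_of_lt (Nat.zero_le _) i.2)) (hs.many i i.2)
  · simp only [eqv_pairStructure, Nat.unpair_pair] at hij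
    exact Fin.ext (by omega)
  · simp only [encard_eqvClass, Nat.unpair_pair]
    exact hs.many i i.2

theorem IsJaniczakSize.realize_sentenceA (hs : IsJaniczakSize q s) {n : ℕ} (hn : n + 1 < q) :
    sizedSet s ⊨ sentenceA n ↔ s (2 * n) = (n + 1 : ℕ) := by
  rw [TuringPersistence.realize_sentenceA (equivalence_pairStructure _)]
  constructor
  · rintro ⟨x, hx⟩
    obtain ⟨m, hm, hxm⟩ := hs.unpair_fst hn hx
    obtain rfl : n = m := by omega
    rwa [encard_eqvClass, hxm] at hx
  · intro h
    refine ⟨⟨Nat.pair (2 * n) 0, ?_⟩, by simp only [encard_eqvClass, Nat.unpair_pair, h]⟩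
    simp [sizedSet, h]

end SizedSet

open Classical in
/-- Class sizes of a model of Janiczak's theory that has a class of size `n + 1` precisely for
`n ∈ X`, and infinitely many infinite classes. -/
noncomputable def modelSize (X : Set ℕ) (k : ℕ) : ℕ∞ :=
  if k % 2 = 0 then (if k / 2 ∈ X then (k / 2 + 1 : ℕ) else 0) else ⊤

theorem isJaniczakSize_modelSize (X : Set ℕ) (q : ℕ) : IsJaniczakSize q (modelSize X) := by
  refine ⟨fun k => ?_, fun k => .inr ?_, fun k _ => ?_⟩
  · by_cases h : k ∈ X
    · exact .inr (by simp [modelSize, h])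
    · exact .inl (by simp [modelSize, h])
  · rw [modelSize, if_neg (by omega)]; exact le_top
  · rw [modelSize, if_neg (by omega)]; exact le_top

/-- A model of Janiczak's theory that has a class of size `n + 1` precisely for `n ∈ X`. -/
abbrev janiczakModel (X : Set ℕ) : Set ℕ :=
  sizedSet (modelSize X)

theorem janiczakModel_model (X : Set ℕ) : janiczakModel X ⊨ theoryJ :=
  model_theoryJ_iff.2 fun q => (isJaniczakSize_modelSize X q).isJaniczak

theorem janiczakModel_realize_sentenceA {X : Set ℕ} {n : ℕ} :
    janiczakModel X ⊨ sentenceA n ↔ n ∈ X := by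
  rw [(isJaniczakSize_modelSize X (n + 2)).realize_sentenceA (by omega)]
  have h₀ : (0 : ℕ∞) ≠ n + 1 := by exact_mod_cast (Nat.succ_ne_zero n).symm
  by_cases h : n ∈ X <;> simp [modelSize, h, h₀]

theorem janiczakModel_nonempty (X : Set ℕ) : Nonempty (janiczakModel X) := by
  obtain ⟨f, -⟩ := (isJaniczakSize_modelSize X 1).isJaniczak.many
  exact ⟨f 0⟩

theorem janiczakModel_model_theoryT {B C X : Set ℕ} (hB : B ⊆ X) (hC : Disjoint X C) :
    janiczakModel X ⊨ theoryT B C := by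
  rw [Theory.model_iff]
  rintro φ ((hφ | ⟨n, hn, rfl⟩) | ⟨n, hn, rfl⟩)
  · exact (Theory.model_iff _).1 (janiczakModel_model X) φ hφ
  · exact janiczakModel_realize_sentenceA.2 (hB hn)
  · exact fun h => Set.disjoint_left.1 hC (janiczakModel_realize_sentenceA.1 h) hn

/-- Class sizes of a finite structure that looks like a model of Janiczak's theory to formulas with
at most `q` variables and quantifiers. The binary digits of `c` say which sizes below `q` occur. -/
def finiteSize (q c k : ℕ) : ℕ :=
  if k % 2 = 0 then (if c / 2 ^ (k / 2) % 2 = 1 ∧ k / 2 + 1 < q then k / 2 + 1 else 0)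
  else if k / 2 < q then q else 0

theorem isJaniczakSize_finiteSize (q c : ℕ) :
    IsJaniczakSize q fun k => (finiteSize q c k : ℕ∞) := by
  refine ⟨fun k => ?_, fun k => ?_, fun k hk => ?_⟩
  · by_cases h : c / 2 ^ k % 2 = 1 ∧ k + 1 < q
    · exact .inr (by simp [finiteSize, h])
    · exact .inl (by simp [finiteSize, h])
  · by_cases h : k < q
    · exact .inr (by simp [finiteSize, Nat.mul_add_div, h])
    · exact .inl (by simp [finiteSize, Nat.mul_add_div, h])
  · simp [finiteSize, Nat.mul_add_div, hk]

/-- The list of the elements of the finite structure with the class sizes `finiteSize q c`. -/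
def finiteUniverse (q c : ℕ) : List ℕ :=
  (List.range ((2 * q) * (2 * q))).filter fun x => x.unpair.2 < finiteSize q c x.unpair.1

theorem finiteSize_le (q c k : ℕ) : finiteSize q c k ≤ q := by
  unfold finiteSize
  split_ifs <;> omega

theorem mem_finiteUniverse {q c x : ℕ} :
    x ∈ finiteUniverse q c ↔ x ∈ sizedSet fun k => (finiteSize q c k : ℕ∞) := by
  have h₀ : (x ∈ sizedSet fun k => (finiteSize q c k : ℕ∞)) ↔
      x.unpair.2 < finiteSize q c x.unpair.1 :=
    Nat.cast_lt (α := ℕ∞)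
  rw [h₀]
  simp only [finiteUniverse, List.mem_filter, List.mem_range, decide_eq_true_eq,
    and_iff_right_iff_imp]
  intro h
  have h₁ := finiteSize_le q c x.unpair.1
  have h₂ : x.unpair.1 < 2 * q := by
    by_contra h'
    have : finiteSize q c x.unpair.1 = 0 := by
      unfold finiteSize
      split_ifs <;> omega
    omega
  rw [← Nat.pair_unpair x]
  refine (Nat.pair_lt_max_add_one_sq _ _).trans_le ?_
  rw [pow_two]
  exact Nat.mul_le_mul (by omega) (by omega)

theorem coe_finiteUniverse (q c : ℕ) :
    {x | x ∈ finiteUniverse q c} = sizedSet fun k => (finiteSize q c k : ℕ∞) :=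
  Set.ext fun _ => mem_finiteUniverse

theorem exists_digits (X : Set ℕ) (q : ℕ) :
    ∃ c < 2 ^ q, ∀ n < q, c / 2 ^ n % 2 = 1 ↔ n ∈ X := by
  classical
  refine ⟨Nat.ofBits fun i : Fin q => decide ((i : ℕ) ∈ X), Nat.ofBits_lt_two_pow _,
    fun n hn => ?_⟩
  have := Nat.testBit_ofBits_lt (fun i : Fin q => decide ((i : ℕ) ∈ X)) n hn
  rw [Nat.testBit_eq_decide_div_mod_eq] at this
  simpa using this

/-- The truth value of the sentence with Gödel number `m` in a model of Janiczak's theory that has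
a class of size `n + 1 < q` precisely if the binary digit number `n` of `c` is `1`. -/
def evalSentence (q c m : ℕ) : Bool :=
  evalNumber (finiteUniverse q c) [] m

/-- Elimination of all sentences but the `A_n`: a sentence with Gödel number at most `q` is decided
in models of Janiczak's theory by the sizes below `q` of their classes. -/
theorem realize_iff_evalSentence {M : Type*} [eqvLang.Structure M] [M ⊨ theoryJ] {q c : ℕ}
    (φ : eqvLang.Sentence) (hq : sentenceNumber φ ≤ q)
    (hc : ∀ n, n + 1 < q → (c / 2 ^ n % 2 = 1 ↔ M ⊨ sentenceA n)) :
    M ⊨ φ ↔ evalSentence q c (sentenceNumber φ) = true := by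
  have hM := model_theoryJ_iff.1 (inferInstance : M ⊨ theoryJ) q
  have hs := isJaniczakSize_finiteSize q c
  have h₁ : M ⊨ φ ↔ {x | x ∈ finiteUniverse q c} ⊨ φ := by
    rw [coe_finiteUniverse]
    refine realize_sentence_iff hM hs.isJaniczak ((samePattern_iff hM.equivalence
      hs.isJaniczak.equivalence).2 fun n hn => ?_) φ hq
    rw [hs.realize_sentenceA hn, ← hc n hn]
    have h₀ : (0 : ℕ∞) ≠ n + 1 := by exact_mod_cast (Nat.succ_ne_zero n).symm
    by_cases h : c / 2 ^ n % 2 = 1 <;> simp [finiteSize, h, hn, h₀]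
  rw [h₁]
  have := evalNumber_iff (finiteUniverse q c) φ (default : Fin 0 → _)
  rw [List.ofFn_zero] at this
  exact this.symm

/-! ### Deciding the theorems -/

section Theorems

variable {B C : Set ℕ}

theorem theoryT_isSatisfiable (h : Disjoint B C) : (theoryT B C).IsSatisfiable :=
  have := janiczakModel_nonempty B
  have := janiczakModel_model_theoryT (Set.Subset.refl B) h
  Theory.Model.isSatisfiable (janiczakModel B)

theorem exists_digits_of_structure (M : Type*) [eqvLang.Structure M] (q : ℕ) :
    ∃ c < 2 ^ q, ∀ n < q, c / 2 ^ n % 2 = 1 ↔ M ⊨ sentenceA n :=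
  exists_digits {n | M ⊨ sentenceA n} q

/-- A sentence with Gödel number `m` is a theorem if and only if it holds for all patterns `c` of
sizes, except for those that contradict `B` or `C` below `m`. -/
theorem models_iff (hBC : Disjoint B C) (φ : eqvLang.Sentence) :
    theoryT B C ⊨ᵇ φ ↔ ∀ c < 2 ^ sentenceNumber φ,
      evalSentence (sentenceNumber φ) c (sentenceNumber φ) = true ∨
        ∃ n < sentenceNumber φ, (n ∈ B ∧ ¬ c / 2 ^ n % 2 = 1) ∨ (n ∈ C ∧ c / 2 ^ n % 2 = 1) := by
  classical
  rw [Theory.models_sentence_iff]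
  set m := sentenceNumber φ with hm
  constructor
  · intro h c _
    by_contra! hcon
    obtain ⟨hcon, hcomp⟩ := hcon
    -- A model whose sizes are prescribed by `c` below `m`, and by `B` from `m` on.
    set X : Set ℕ := {n | if n < m then c / 2 ^ n % 2 = 1 else n ∈ B} with hX
    have hBX : B ⊆ X := fun n hn => by
      by_cases hnm : n < m
      · simpa [hX, hnm] using (hcomp n hnm).1 hn
      · simpa [hX, hnm] using hn
    have hXC : Disjoint X C := Set.disjoint_left.2 fun n hn hnC => by
      by_cases hnm : n < m
      · simp only [hX, Set.mem_ofPred_eq, hnm, if_true] at hn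
        exact (hcomp n hnm).2 hnC hn
      · simp only [hX, Set.mem_ofPred_eq, hnm, if_false] at hn
        exact Set.disjoint_left.1 hBC hn hnC
    have := janiczakModel_nonempty X
    have := janiczakModel_model_theoryT hBX hXC
    have := janiczakModel_model X
    refine hcon ((realize_iff_evalSentence (M := janiczakModel X) φ le_rfl fun n hn => ?_).1
      (h (Theory.ModelType.of (theoryT B C) (janiczakModel X))))
    rw [janiczakModel_realize_sentenceA]
    simp only [hX, Set.mem_ofPred_eq]
    rw [if_pos (by omega)]
  · intro h M
    have hMT := (Theory.model_iff (T := theoryT B C) (M := M)).1 inferInstance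
    have : M ⊨ theoryJ := (Theory.model_iff _).2 fun φ hφ => hMT φ (.inl (.inl hφ))
    obtain ⟨c, hcm, hc⟩ := exists_digits_of_structure M m
    refine (realize_iff_evalSentence φ le_rfl fun n hn => hc n (by omega)).2
      ((h c hcm).resolve_right ?_)
    rintro ⟨n, hn, ⟨hnB, hcn⟩ | ⟨hnC, hcn⟩⟩
    · exact hcn ((hc n hn).2 (hMT _ (.inl (.inr ⟨n, hnB, rfl⟩))))
    · exact hMT _ (.inr ⟨n, hnC, rfl⟩) ((hc n hn).1 hcn)

theorem isFormulaNumber_iff_sentence {m : ℕ} :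
    isFormulaNumber [] m = true ↔ ∃ φ : eqvLang.Sentence, sentenceNumber φ = m :=
  isFormulaNumber_iff rfl

/-- What is known at stage `s` of the enumeration of the pair suffices to see that the sentence
with Gödel number `m` is a theorem. -/
def ProvableAt (e : Code) (m s : ℕ) : Prop :=
  isFormulaNumber [] m = true ∧ ∀ c < 2 ^ m, evalSentence m c m = true ∨
    ∃ n < m, (LoAt e s n ∧ ¬ c / 2 ^ n % 2 = 1) ∨ (HiAt e s n ∧ c / 2 ^ n % 2 = 1)

theorem mem_provable_iff (hBC : Disjoint B C) {m : ℕ} :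
    m ∈ provable (theoryT B C) ↔ isFormulaNumber [] m = true ∧
      ∀ c < 2 ^ m, evalSentence m c m = true ∨
        ∃ n < m, (n ∈ B ∧ ¬ c / 2 ^ n % 2 = 1) ∨ (n ∈ C ∧ c / 2 ^ n % 2 = 1) := by
  constructor
  · rintro ⟨φ, h, rfl⟩
    exact ⟨isFormulaNumber_iff_sentence.2 ⟨φ, rfl⟩, (models_iff hBC φ).1 h⟩
  · rintro ⟨h, h'⟩
    obtain ⟨φ, rfl⟩ := isFormulaNumber_iff_sentence.1 h
    exact ⟨φ, (models_iff hBC φ).2 h', rfl⟩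

/-- Once all elements `x ≤ m` of `A` have appeared, it is decided whether `m` is the Gödel number of
a theorem. -/
theorem mem_provable_iff_of_stage {e : Code} {m s : ℕ}
    (h : ∀ x ≤ m, x ∈ reSet e → InStage e s x) :
    m ∈ provable (theoryT (loSet e) (hiSet e)) ↔ ProvableAt e m s := by
  rw [mem_provable_iff disjoint_loSet_hiSet, ProvableAt]
  refine and_congr_right fun _ => forall₂_congr fun c _ => or_congr_right
    (exists_congr fun n => and_congr_right fun hn => ?_)
  have h' := h n.unpair.2 ((Nat.unpair_right_le n).trans hn.le)
  rw [mem_loSet_iff h', mem_hiSet_iff h']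

theorem ProvableAt.mem_provable {e : Code} {m s : ℕ} (h : ProvableAt e m s) :
    m ∈ provable (theoryT (loSet e) (hiSet e)) := by
  refine (mem_provable_iff disjoint_loSet_hiSet).2 ⟨h.1, fun c hc => (h.2 c hc).imp id ?_⟩
  rintro ⟨n, hn, h | h⟩
  · exact ⟨n, hn, .inl ⟨⟨s, h.1⟩, h.2⟩⟩
  · exact ⟨n, hn, .inr ⟨⟨s, h.1⟩, h.2⟩⟩

theorem provable_eq {e : Code} :
    provable (theoryT (loSet e) (hiSet e)) = {m | ∃ s, ProvableAt e m s} := by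
  refine Set.ext fun m => ⟨fun h => ?_, fun ⟨s, h⟩ => h.mem_provable⟩
  have : ∃ s, ∀ x ≤ m, x ∈ reSet e → InStage e s x := by
    have : ∀ x, ∃ s, x ∈ reSet e → InStage e s x := fun x => by
      by_cases hx : x ∈ reSet e
      · exact (mem_reSet_iff.1 hx).imp fun s hs _ => hs
      · exact ⟨0, fun h => absurd h hx⟩
    choose f hf using this
    refine ⟨(Finset.range (m + 1)).sup f, fun x hx h => (hf x h).mono
      (Finset.le_sup (f := f) (by simpa using Nat.lt_succ_of_le hx))⟩
  obtain ⟨s, hs⟩ := this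
  exact ⟨s, (mem_provable_iff_of_stage hs).1 h⟩

end Theorems

section Primrec

open Primrec

theorem primrec_two_pow : Primrec fun n : ℕ => 2 ^ n :=
  (nat_rec₁ (f := fun _ y => 2 * y) 1 (nat_double.comp snd).to₂).of_eq fun n => by
    induction n with
    | zero => rfl
    | succ n ih => rw [pow_succ, ← ih, mul_comm]

theorem primrecRel_digit : PrimrecRel fun c n : ℕ => c / 2 ^ n % 2 = 1 :=
  Primrec.eq.comp (nat_mod.comp (nat_div.comp fst (primrec_two_pow.comp snd)) (const 2)) (const 1)

theorem primrec_finiteSize : Primrec fun p : (ℕ × ℕ) × ℕ => finiteSize p.1.1 p.1.2 p.2 := by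
  have hq : Primrec fun p : (ℕ × ℕ) × ℕ => p.1.1 := fst.comp fst
  have hk : Primrec fun p : (ℕ × ℕ) × ℕ => p.2 / 2 := nat_div.comp snd (const 2)
  refine ite (Primrec.eq.comp (nat_mod.comp snd (const 2)) (const 0))
    (ite (PrimrecPred.and (primrecRel_digit.comp (snd.comp fst) hk)
      (nat_lt.comp (succ.comp hk) hq)) (succ.comp hk) (const 0))
    (ite (nat_lt.comp hk hq) hq (const 0))

theorem primrec₂_finiteUniverse : Primrec₂ finiteUniverse := by
  have h : PrimrecRel fun (x : ℕ) (p : ℕ × ℕ) => x.unpair.2 < finiteSize p.1 p.2 x.unpair.1 :=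
    nat_lt.comp (snd.comp (unpair.comp fst))
      (primrec_finiteSize.comp (snd.pair (fst.comp (unpair.comp fst))))
  have hq : Primrec fun p : ℕ × ℕ => 2 * p.1 := nat_double.comp fst
  exact h.listFilter.comp (list_range.comp (nat_mul.comp hq hq)) Primrec.id

theorem primrec_evalSentence :
    Primrec fun p : (ℕ × ℕ) × ℕ => evalSentence p.1.1 p.1.2 p.2 :=
  (primrec_foldNumber primrec₂_evalStep).comp
    ((primrec₂_finiteUniverse.comp (fst.comp fst) (snd.comp fst)).pair ((const []).pair snd))

theorem primrec_isFormulaNumber : Primrec (isFormulaNumber []) :=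
  (primrec_foldNumber primrec₂_wfStep).comp ((const [0]).pair ((const []).pair Primrec.id))

theorem primrecPred_provableAt :
    PrimrecPred fun p : (Code × ℕ) × ℕ => ProvableAt p.1.1 p.1.2 p.2 := by
  have hm : Primrec fun p : (Code × ℕ) × ℕ => p.1.2 := snd.comp fst
  have hn : PrimrecRel fun (n : ℕ) (r : ℕ × (Code × ℕ) × ℕ) =>
      (LoAt r.2.1.1 r.2.2 n ∧ ¬ r.1 / 2 ^ n % 2 = 1) ∨
        (HiAt r.2.1.1 r.2.2 n ∧ r.1 / 2 ^ n % 2 = 1) := by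
    have h₀ : Primrec fun t : ℕ × ℕ × (Code × ℕ) × ℕ => ((t.2.2.1.1, t.1), t.2.2.2) :=
      ((fst.comp (fst.comp (snd.comp snd))).pair fst).pair (snd.comp (snd.comp snd))
    have h₁ := primrecRel_digit.comp
      (fst.comp snd : Primrec fun t : ℕ × ℕ × (Code × ℕ) × ℕ => t.2.1) fst
    exact ((primrecPred_atStage.1.comp h₀).and h₁.not).or ((primrecPred_atStage.2.comp h₀).and h₁)
  have hc : PrimrecRel fun (c : ℕ) (p : (Code × ℕ) × ℕ) => evalSentence p.1.2 c p.1.2 = true ∨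
      ∃ n ∈ List.range p.1.2, (LoAt p.1.1 p.2 n ∧ ¬ c / 2 ^ n % 2 = 1) ∨
        (HiAt p.1.1 p.2 n ∧ c / 2 ^ n % 2 = 1) :=
    PrimrecPred.or
      (Primrec.eq.comp (primrec_evalSentence.comp
        (((hm.comp snd).pair fst).pair (hm.comp snd))) (const true))
      (hn.exists_mem_list.comp (list_range.comp (hm.comp snd)) Primrec.id)
  refine ((Primrec.eq.comp (primrec_isFormulaNumber.comp hm) (const true)).and
    (hc.forall_mem_list.comp (list_range.comp (primrec_two_pow.comp hm)) Primrec.id)).of_eq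
      fun p => ?_
  simp [ProvableAt]

end Primrec

theorem provable_turingLE {e : Code} :
    TuringLE (provable (theoryT (loSet e) (hiSet e))) (reSet e) :=
  turingLE_of_stage (R := fun m s => ProvableAt e m s)
    (primrecPred_provableAt.comp ((Primrec.const e).pair Primrec.fst |>.pair
      Primrec.snd)).computablePred fun _ _ h => mem_provable_iff_of_stage h

theorem isConsistentRE_theoryT {e : Code} : IsConsistentRE (theoryT (loSet e) (hiSet e)) := by
  refine ⟨theoryT_isSatisfiable disjoint_loSet_hiSet, ?_⟩
  rw [provable_eq]
  exact isRE_setOf_exists (primrecPred_provableAt.comp ((Primrec.const e).pair Primrec.fst |>.pair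
    Primrec.snd))

/-! ### Inseparability and persistence -/

/-- From `n` one can compute the Gödel number of a sentence that Janiczak's theory proves equivalent
to `A_n`: a search finds one, because equivalence to `A_n` is decidable. -/
theorem exists_computable_sentenceA : ∃ g : ℕ → ℕ, Computable g ∧ ∀ n, ∃ φ : eqvLang.Sentence,
    sentenceNumber φ = g n ∧
      ∀ (M : Type) [eqvLang.Structure M] [M ⊨ theoryJ], M ⊨ φ ↔ M ⊨ sentenceA n := by
  classical
  -- Patterns of `m + n + 2` digits are long enough to decide the sentence with Gödel number `m` and
  -- to contain the digit that decides `A_n`.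
  let P : ℕ → ℕ → Prop := fun n m => isFormulaNumber [] m = true ∧
    ∀ c < 2 ^ (m + n + 2), evalSentence (m + n + 2) c m = true ↔ c / 2 ^ n % 2 = 1
  have hex : ∀ n, ∃ m, P n m := by
    intro n
    refine ⟨sentenceNumber (sentenceA n), isFormulaNumber_iff_sentence.2 ⟨_, rfl⟩, fun c _ => ?_⟩
    set q := sentenceNumber (sentenceA n) + n + 2 with hq
    set X : Set ℕ := {k | c / 2 ^ k % 2 = 1}
    have := janiczakModel_model X
    have hX : ∀ k, janiczakModel X ⊨ sentenceA k ↔ c / 2 ^ k % 2 = 1 := fun k =>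
      janiczakModel_realize_sentenceA
    rw [← realize_iff_evalSentence (M := janiczakModel X) (sentenceA n) (by omega)
      fun k _ => (hX k).symm, hX]
  have hP : PrimrecPred fun p : ℕ × ℕ => P p.1 p.2 := by
    have hq : Primrec fun p : ℕ × ℕ => p.2 + p.1 + 2 := Primrec.nat_add.comp
      (Primrec.nat_add.comp Primrec.snd Primrec.fst) (Primrec.const 2)
    have h₁ : PrimrecRel fun (c : ℕ) (p : ℕ × ℕ) =>
        evalSentence (p.2 + p.1 + 2) c p.2 = decide (c / 2 ^ p.1 % 2 = 1) :=
      Primrec.eq.comp (primrec_evalSentence.comp (((hq.comp Primrec.snd).pair Primrec.fst).pair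
        (Primrec.snd.comp Primrec.snd)))
        (primrecRel_digit.comp Primrec.fst (Primrec.fst.comp Primrec.snd)).decide
    refine ((Primrec.eq.comp (primrec_isFormulaNumber.comp Primrec.snd) (Primrec.const true)).and
      (h₁.forall_mem_list.comp (Primrec.list_range.comp (primrec_two_pow.comp hq))
        Primrec.id)).of_eq fun p => ?_
    refine and_congr_right fun _ => forall_congr' fun c => ?_
    rw [List.mem_range, Bool.eq_iff_iff, decide_eq_true_iff]
    rfl
  refine ⟨fun n => Nat.find (hex n), Computable.find hP.computablePred hex, fun n => ?_⟩
  obtain ⟨h₁, h₂⟩ := Nat.find_spec (hex n)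
  obtain ⟨φ, hφ⟩ := isFormulaNumber_iff_sentence.1 h₁
  refine ⟨φ, hφ, fun M _ _ => ?_⟩
  rw [← hφ] at h₂
  set q := sentenceNumber φ + n + 2 with hq
  obtain ⟨c, hcq, hc⟩ := exists_digits_of_structure M q
  rw [realize_iff_evalSentence (q := q) φ (by omega) fun k hk => hc k (by omega), h₂ c hcq,
    hc n (by omega)]

theorem models_sentenceA_of_mem {B C : Set ℕ} {n : ℕ} {φ : eqvLang.Sentence}
    (hφ : ∀ (M : Type) [eqvLang.Structure M] [M ⊨ theoryJ], M ⊨ φ ↔ M ⊨ sentenceA n) :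
    (n ∈ B → theoryT B C ⊨ᵇ φ) ∧ (n ∈ C → theoryT B C ⊨ᵇ Formula.not φ) := by
  refine ⟨fun hn => Theory.models_sentence_iff.2 fun M => ?_,
    fun hn => Theory.models_sentence_iff.2 fun M => ?_⟩ <;>
  · have hMT := (Theory.model_iff (T := theoryT B C) (M := M)).1 inferInstance
    have : M ⊨ theoryJ := (Theory.model_iff _).2 fun ψ hψ => hMT ψ (.inl (.inl hψ))
    first
    | exact (hφ M).2 (hMT _ (.inl (.inr ⟨n, hn, rfl⟩)))
    | exact fun h => hMT _ (.inr ⟨n, hn, rfl⟩) ((hφ M).1 h)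

theorem not_models_and_models_not {L : FirstOrder.Language.{0, 0}} {S : L.Theory}
    (hS : S.IsSatisfiable) (φ : L.Sentence) : ¬ (S ⊨ᵇ φ ∧ S ⊨ᵇ Formula.not φ) := by
  rintro ⟨h₁, h₂⟩
  obtain ⟨M⟩ := hS
  exact Theory.models_sentence_iff.1 h₂ M (Theory.models_sentence_iff.1 h₁ M)

/-- A consistent recursively enumerable theory that contains a computable image of the theory
computes the set `A` with index `e`, because the sentences equivalent to the `A_n` that it proves
are a recursively enumerable separating set. -/
theorem turingLE_provable {e : Code} {L' : FirstOrder.Language.{0, 0}}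
    [Encodable (Σ n, L'.Functions n)] [Encodable (Σ n, L'.Relations n)]
    {tr : eqvLang.Sentence → L'.Sentence} (htr : ∀ φ, tr (Formula.not φ) = Formula.not (tr φ))
    {f : ℕ → ℕ} (hf : Computable f) (hftr : ∀ φ, f (sentenceNumber φ) = sentenceNumber (tr φ))
    {S : L'.Theory} (hS : IsConsistentRE S)
    (h : ∀ φ, theoryT (loSet e) (hiSet e) ⊨ᵇ φ → S ⊨ᵇ tr φ) :
    TuringLE (reSet e) (provable S) := by
  obtain ⟨g, hg, hgφ⟩ := exists_computable_sentenceA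
  have hfg : Computable fun n => f (g n) := hf.comp hg
  refine (turingLE_of_separates (hS.2.preimage hfg) ⟨fun n hn => ?_,
    Set.disjoint_left.2 fun n hn hn' => ?_⟩).trans (turingLE_preimage hfg)
  · obtain ⟨φ, hφ, hφA⟩ := hgφ n
    exact ⟨tr φ, h φ ((models_sentenceA_of_mem hφA).1 hn),
      (hftr φ).symm.trans (congrArg f hφ)⟩
  · obtain ⟨φ, hφ, hφA⟩ := hgφ n
    obtain ⟨ψ, hψ, hψn⟩ := hn
    obtain rfl := sentenceNumber_injective (hψn.trans ((congrArg f hφ.symm).trans (hftr φ)))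
    exact not_models_and_models_not hS.1 _
      ⟨hψ, htr φ ▸ h _ ((models_sentenceA_of_mem hφA).2 hn')⟩

theorem reSet_turingLE_provable {e : Code} :
    TuringLE (reSet e) (provable (theoryT (loSet e) (hiSet e))) :=
  turingLE_provable (tr := id) (f := id) (fun _ => rfl) Computable.id (fun _ => rfl)
    isConsistentRE_theoryT fun _ h => h

theorem isTuringPersistent_theoryT {e : Code} (he : degree (reSet e) ≠ degree ∅) :
    IsTuringPersistent (theoryT (loSet e) (hiSet e)) := by
  refine ⟨isConsistentRE_theoryT,
    fun h => he (degree_eq_degree_empty reSet_turingLE_provable h), ?_⟩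
  rintro L' _ _ ι S - ⟨f, hf, hfι⟩ hS h
  exact provable_turingLE.trans (turingLE_provable (tr := ι.onSentence)
    (fun _ => rfl) hf hfι hS h)

/-- `φ` is refutable if `φ → ⊥` is provable, and the Gödel number of the latter is computable. -/
theorem refutable_eq_preimage {T : eqvLang.Theory} :
    refutable T = (fun m => Nat.pair 3 (Nat.pair m (Nat.pair 0 0))) ⁻¹' provable T := by
  ext m
  constructor
  · rintro ⟨φ, h, rfl⟩
    exact ⟨_, h, rfl⟩
  · rintro ⟨ψ, h, hψ⟩
    rw [sentenceNumber] at hψ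
    cases ψ with
    | imp φ χ =>
      simp only [formulaNumber, Nat.pair_eq_pair, true_and] at hψ
      obtain rfl : χ = ⊥ := formulaNumber_injective (hψ.2.trans rfl)
      exact ⟨φ, h, hψ.1⟩
    | _ => simp [formulaNumber, Nat.pair_eq_pair] at hψ

theorem isRecInseparable_theoryT {e : Code} (he : degree (reSet e) ≠ degree ∅) :
    IsRecInseparable (theoryT (loSet e) (hiSet e)) := by
  have hT := isConsistentRE_theoryT (e := e)
  refine ⟨hT, hT.2, ?_, ?_, ?_⟩
  · rw [refutable_eq_preimage]
    exact hT.2.preimage (Primrec₂.natPair.comp (Primrec.const 3)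
      (Primrec₂.natPair.comp Primrec.id (Primrec.const _))).to_comp
  · refine Set.disjoint_left.2 ?_
    rintro _ ⟨φ, h, rfl⟩ ⟨ψ, h', hψ⟩
    obtain rfl := sentenceNumber_injective hψ
    exact not_models_and_models_not hT.1 _ ⟨h, h'⟩
  · rintro ⟨X, hX, hsub, hdisj⟩
    obtain ⟨g, hg, hgφ⟩ := exists_computable_sentenceA
    refine (isRIPair_loSet_hiSet he).2.2.2 ⟨_, hX.preimage hg, fun n hn => ?_,
      Set.disjoint_left.2 fun n hn hn' => Set.disjoint_left.1 hdisj hn ?_⟩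
    · obtain ⟨φ, hφ, hφA⟩ := hgφ n
      exact hsub ⟨φ, (models_sentenceA_of_mem hφA).1 hn, hφ⟩
    · obtain ⟨φ, hφ, hφA⟩ := hgφ n
      exact ⟨φ, (models_sentenceA_of_mem hφA).2 hn', hφ⟩

/-- The indices of the pair and of the theory, uniformly in the index `e`. -/
theorem exists_indices : ∃ b c t : Code → Code, Computable b ∧ Computable c ∧ Computable t ∧
    ∀ e, reSet (b e) = loSet e ∧ reSet (c e) = hiSet e ∧
      reSet (t e) = provable (theoryT (loSet e) (hiSet e)) := by
  obtain ⟨b, hb, hb'⟩ := exists_computable_index (P := fun e n s => LoAt e s n)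
    primrecPred_atStage.1
  obtain ⟨c, hc, hc'⟩ := exists_computable_index (P := fun e n s => HiAt e s n)
    primrecPred_atStage.2
  obtain ⟨t, ht, ht'⟩ := exists_computable_index primrecPred_provableAt
  exact ⟨b, c, t, hb, hc, ht, fun e => ⟨hb' e, hc' e, (ht' e).trans provable_eq.symm⟩⟩

/-! ### The semantics of translations -/

namespace Translation

variable {L L' : FirstOrder.Language.{0, 0}} (τ : Translation L L') {M : Type*} [L'.Structure M]

/-- The assignment given by the parameters `p` and the blocks `w`. -/
def blockVal (p : Fin τ.params → M) {V : Type} (w : V → Fin τ.dim → M) :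
    Fin τ.params ⊕ V × Fin τ.dim → M :=
  Sum.elim p fun x => w x.1 x.2

variable {τ} {p : Fin τ.params → M}

theorem realize_existsValues {V : Type} {k : ℕ} {g : Fin k → τ.BlockFormula (Option V)}
    {ψ : τ.BlockFormula (V ⊕ Fin k)} {w : V → Fin τ.dim → M} :
    (τ.existsValues g ψ).Realize (τ.blockVal p w) ↔ ∃ z : Fin k → Fin τ.dim → M,
      (∀ i, τ.dom.Realize (Sum.elim p (z i)) ∧
        (g i).Realize (τ.blockVal p fun o => o.elim (z i) w)) ∧
      ψ.Realize (τ.blockVal p (Sum.elim w z)) := by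
  rw [existsValues, Formula.realize_iExs]
  have key : ∀ z : Fin k → Fin τ.dim → M,
      (Sum.elim (τ.blockVal p w) fun x : Fin k × Fin τ.dim => z x.1 x.2) ∘
        (Sum.elim (fun p => .inl (.inl p))
          fun x => Sum.elim (fun v => .inl (.inr (v, x.2))) (fun i => .inr (i, x.2)) x.1) =
      τ.blockVal p (Sum.elim w z) := by
    intro z
    funext x
    rcases x with x | ⟨x | x, y⟩ <;> rfl
  have key₂ : ∀ (z : Fin k → Fin τ.dim → M) (i : Fin k), τ.blockVal p (Sum.elim w z) ∘
      (Sum.map id fun j => ((Sum.inr i : V ⊕ Fin k), j)) = Sum.elim p (z i) := by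
    intro z i
    funext x
    rcases x with x | x <;> rfl
  have key₃ : ∀ (z : Fin k → Fin τ.dim → M) (i : Fin k), τ.blockVal p (Sum.elim w z) ∘
      (Sum.map id (Prod.map (fun v : Option V => v.elim (Sum.inr i) Sum.inl) id)) =
        τ.blockVal p fun o => o.elim (z i) w := by
    intro z i
    funext x
    rcases x with x | ⟨_ | x, y⟩ <;> rfl
  constructor
  · rintro ⟨z, hz⟩
    refine ⟨fun i j => z (i, j), ?_⟩
    rw [Formula.realize_relabel] at hz
    have hz' := key fun i j => z (i, j)
    simp only [Prod.mk.eta] at hz'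
    rw [hz', Formula.realize_inf, Formula.realize_iInf] at hz
    simpa only [Formula.realize_inf, Formula.realize_relabel, key₂, key₃] using hz
  · rintro ⟨z, hz⟩
    refine ⟨fun x => z x.1 x.2, ?_⟩
    rw [Formula.realize_relabel, key, Formula.realize_inf, Formula.realize_iInf]
    simpa only [Formula.realize_inf, Formula.realize_relabel, key₂, key₃] using hz

/-- The blocks `x` and `y` satisfy the translation of identity. -/
def EqBlock (p : Fin τ.params → M) (x y : Fin τ.dim → M) : Prop :=
  τ.eq.Realize (τ.blockVal p ![x, y])

theorem realize_valueIs_var {V : Type} {v : V} {w : Option V → Fin τ.dim → M} :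
    (τ.valueIs (.var v)).Realize (τ.blockVal p w) ↔ EqBlock p (w (some v)) (w none) := by
  rw [valueIs, Formula.realize_relabel, EqBlock]
  refine iff_of_eq (congrArg _ (funext fun x => ?_))
  rcases x with x | ⟨x, y⟩
  · rfl
  · fin_cases x <;> rfl

/-- The translation of ‘the value of `t` is `y`’ commutes with renaming the variables of `t`. -/
theorem realize_valueIs_relabel {V V' : Type} {t : L.Term V} {g : V → V'}
    {w : Option V' → Fin τ.dim → M} :
    (τ.valueIs (t.relabel g)).Realize (τ.blockVal p w) ↔
      (τ.valueIs t).Realize (τ.blockVal p fun o => w (o.map g)) := by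
  induction t generalizing w with
  | var v => rw [Term.relabel, realize_valueIs_var, realize_valueIs_var]; rfl
  | @func l f ts ih =>
    rw [Term.relabel, valueIs, valueIs, realize_existsValues, realize_existsValues]
    refine exists_congr fun z => and_congr (forall_congr' fun i => and_congr_right fun _ => ?_) ?_
    · rw [Formula.realize_relabel, Formula.realize_relabel]
      have h₁ : ∀ {W : Type} (u : Option W → Fin τ.dim → M),
          (τ.blockVal p fun o : Option (Option W) => o.elim (z i) u) ∘
            (Sum.map id (Prod.map (Option.map some) id)) =
          τ.blockVal p fun o : Option W => o.elim (z i) fun v => u (some v) := by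
        intro W u
        funext x
        rcases x with x | ⟨_ | x, y⟩ <;> rfl
      rw [h₁, h₁, ih]
      refine iff_of_eq (congrArg _ (congrArg _ (funext fun o => ?_)))
      rcases o with _ | o <;> rfl
    · rw [Formula.realize_relabel, Formula.realize_relabel]
      refine iff_of_eq (congrArg _ (funext fun x => ?_))
      rcases x with x | ⟨x, y⟩
      · rfl
      · refine Fin.lastCases ?_ (fun x => ?_) x <;> simp [blockVal]

/-- The blocks `xs` satisfy the translation of `φ`. -/
def Sat (p : Fin τ.params → M) {n : ℕ} (φ : L.BoundedFormula Empty n)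
    (xs : Fin n → Fin τ.dim → M) : Prop :=
  (τ.formula φ).Realize (τ.blockVal p (Sum.elim Empty.elim xs))

/-- The block `x` belongs to the domain. -/
def InDom (p : Fin τ.params → M) (x : Fin τ.dim → M) : Prop :=
  τ.dom.Realize (Sum.elim p x)

variable {n : ℕ} {φ ψ : L.BoundedFormula Empty n} {xs : Fin n → Fin τ.dim → M}

theorem sat_imp : Sat p (φ.imp ψ) xs ↔ (Sat p φ xs → Sat p ψ xs) :=
  Formula.realize_imp

theorem sat_not : Sat p φ.not xs ↔ ¬ Sat p φ xs :=
  Formula.realize_imp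

theorem sat_all {φ : L.BoundedFormula Empty (n + 1)} :
    Sat p φ.all xs ↔ ∀ x, InDom p x → Sat p φ (Fin.snoc xs x) := by
  rw [Sat, formula, Formula.realize_iAlls]
  refine forall_congr' fun x => ?_
  rw [Formula.realize_imp, Formula.realize_relabel, Formula.realize_relabel, Sat, InDom]
  refine iff_of_eq (congrArg₂ (fun a b : Prop => a → b) (congrArg _ (funext fun y => ?_))
    (congrArg _ (funext fun y => ?_)))
  · rcases y with y | y <;> rfl
  · rcases y with y | ⟨y | y, z⟩
    · rfl
    · exact y.elim
    · refine Fin.lastCases ?_ (fun y => ?_) y <;> simp [blockVal]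

theorem sat_ex {φ : L.BoundedFormula Empty (n + 1)} :
    Sat p φ.ex xs ↔ ∃ x, InDom p x ∧ Sat p φ (Fin.snoc xs x) := by
  rw [BoundedFormula.ex, sat_not, sat_all]
  simp only [sat_not]
  push Not
  rfl

theorem sat_equal {t₁ t₂ : L.Term (Empty ⊕ Fin n)} :
    Sat p (.equal t₁ t₂) xs ↔ ∃ z₁ z₂,
      (InDom p z₁ ∧ (τ.valueIs t₁).Realize
        (τ.blockVal p fun o => o.elim z₁ (Sum.elim Empty.elim xs))) ∧
      (InDom p z₂ ∧ (τ.valueIs t₂).Realize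
        (τ.blockVal p fun o => o.elim z₂ (Sum.elim Empty.elim xs))) ∧ EqBlock p z₁ z₂ := by
  rw [Sat, formula, realize_existsValues]
  have h : ∀ z : Fin 2 → Fin τ.dim → M, (τ.eq.relabel (Sum.map id (Prod.map Sum.inr id))).Realize
      (τ.blockVal p (Sum.elim (Sum.elim Empty.elim xs) z)) ↔ EqBlock p (z 0) (z 1) := by
    intro z
    rw [Formula.realize_relabel, EqBlock]
    refine iff_of_eq (congrArg _ (funext fun x => ?_))
    rcases x with x | ⟨x, y⟩
    · rfl
    · fin_cases x <;> rfl
  simp only [h, Fin.forall_fin_two]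
  exact ⟨fun ⟨z, h₁, h₂⟩ => ⟨z 0, z 1, h₁.1, h₁.2, h₂⟩,
    fun ⟨z₁, z₂, h₁, h₂, h₃⟩ => ⟨![z₁, z₂], ⟨h₁, h₂⟩, h₃⟩⟩

theorem realize_sentence {φ : L.Sentence} :
    M ⊨ τ.sentence φ ↔ ∀ p, τ.paramDom.Realize p → Sat p φ (Fin.elim0 : Fin 0 → Fin τ.dim → M) := by
  rw [Sentence.Realize, sentence, Formula.realize_iAlls]
  refine forall_congr' fun p => ?_
  rw [Formula.realize_relabel, Formula.realize_imp, Formula.realize_relabel, Sat]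
  refine iff_of_eq (congrArg₂ (fun a b : Prop => a → b) rfl (congrArg _ (funext fun y => ?_)))
  rcases y with y | ⟨y | y, z⟩
  · rfl
  · exact y.elim
  · exact y.elim0

theorem realize_paramsExist : M ⊨ τ.paramsExist ↔ ∃ p : Fin τ.params → M, τ.paramDom.Realize p := by
  rw [Sentence.Realize, paramsExist, Formula.realize_iExs]
  refine exists_congr fun p => ?_
  rw [Formula.realize_relabel]
  rfl

end Translation

/-! ### Theorems of R about numerals -/

theorem numeral_relabel {α β : Type} (g : α → β) (n : ℕ) :
    (numeral n).relabel g = (numeral n : arith.Term β) := by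
  induction n with
  | zero => exact congrArg (Term.func (L := arith) ArithFunc.zero) (funext fun i => i.elim0)
  | succ n ih =>
    refine congrArg (Term.func (L := arith) ArithFunc.succ) (funext fun i => ?_)
    fin_cases i
    exact ih

section NumeralValue

variable {N : Type*} [arith.Structure N]

/-- The value of the numeral of `n`. -/
def numeralValue (N : Type*) [arith.Structure N] (n : ℕ) : N :=
  (numeral n : arith.Term Empty).realize Empty.elim

theorem realize_numeral {α : Type} (v : α → N) (n : ℕ) :
    (numeral n : arith.Term α).realize v = numeralValue N n := by
  rw [numeralValue, ← numeral_relabel (Empty.elim : Empty → α) n, Term.realize_relabel]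
  congr 1
  funext x
  exact x.elim

theorem realize_addTerm {α : Type} (v : α → N) (s t : arith.Term α) :
    (addTerm s t).realize v =
      Structure.funMap (L := arith) ArithFunc.add ![s.realize v, t.realize v] := by
  refine congrArg (Structure.funMap (L := arith) ArithFunc.add) (funext fun i => ?_)
  fin_cases i <;> rfl

theorem realize_leFormula {n : ℕ} {s t : arith.Term (Empty ⊕ Fin n)} {v : Empty → N}
    {xs : Fin n → N} : (leFormula s t).Realize v xs ↔ ∃ z : N,
      Structure.funMap (L := arith) ArithFunc.add ![z, s.realize (Sum.elim v xs)] =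
        t.realize (Sum.elim v xs) := by
  rw [leFormula, BoundedFormula.realize_ex]
  refine exists_congr fun z => ?_
  have h : (Sum.elim v (Fin.snoc xs z : Fin (n + 1) → N)) ∘ Sum.map id Fin.castSucc =
      Sum.elim v xs := by
    funext x
    rcases x with x | x <;> simp
  rw [BoundedFormula.realize_bdEqual, realize_addTerm, Term.realize_relabel, Term.realize_relabel,
    h]
  simp

end NumeralValue

/-- The sentence ‘some `x` is equal to the numeral of `n`’. -/
def existsNumeral (n : ℕ) : arith.Sentence :=
  (BoundedFormula.equal (n := 1) (.var (.inr 0)) (numeral n)).ex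

/-- The formula `x_0 ≤ x_1`. -/
def leVars : arith.BoundedFormula Empty 2 :=
  leFormula (.var (.inr 0)) (.var (.inr 1))

/-- The sentence ‘if `x` and `y` are equal to the numerals of `m` and `n`, then `φ`’. -/
def ofNumerals (φ : arith.BoundedFormula Empty 2) (m n : ℕ) : arith.Sentence :=
  ((BoundedFormula.equal (n := 2) (.var (.inr 0)) (numeral m)).imp
    ((BoundedFormula.equal (n := 2) (.var (.inr 1)) (numeral n)).imp φ)).all.all

theorem realize_ofNumerals {N : Type*} [arith.Structure N] {φ : arith.BoundedFormula Empty 2}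
    {m n : ℕ} : N ⊨ ofNumerals φ m n ↔
      φ.Realize (default : Empty → N) ![numeralValue N m, numeralValue N n] := by
  have h : ∀ x y : N, (Fin.snoc (Fin.snoc (default : Fin 0 → N) x) y : Fin 2 → N) = ![x, y] := by
    intro x y
    funext i
    fin_cases i <;> rfl
  have h' : N ⊨ ofNumerals φ m n ↔ ∀ x y : N, x = numeralValue N m → y = numeralValue N n →
      φ.Realize (default : Empty → N) ![x, y] := by
    refine BoundedFormula.realize_all.trans (forall_congr' fun x =>
      BoundedFormula.realize_all.trans (forall_congr' fun y => ?_))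
    rw [h, BoundedFormula.realize_imp, BoundedFormula.realize_imp]
    refine imp_congr ?_ (imp_congr ?_ Iff.rfl)
    · change x = (numeral m).realize (Sum.elim default ![x, y]) ↔ _
      rw [realize_numeral]
    · change y = (numeral n).realize (Sum.elim default ![x, y]) ↔ _
      rw [realize_numeral]
  rw [h']
  exact ⟨fun h => h _ _ rfl rfl, by rintro h _ _ rfl rfl; exact h⟩

theorem theoryR_models_existsNumeral (n : ℕ) : theoryR ⊨ᵇ existsNumeral n := by
  refine Theory.models_sentence_iff.2 fun N => ?_
  refine BoundedFormula.realize_ex.2 ⟨numeralValue N n, ?_⟩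
  exact (realize_numeral _ n).symm

theorem theoryR_models_le {m n : ℕ} (h : m ≤ n) : theoryR ⊨ᵇ ofNumerals leVars m n := by
  refine Theory.models_sentence_iff.2 fun N => ?_
  have hN := (Theory.model_iff (T := theoryR) (M := N)).1 inferInstance (axAdd (n - m) m)
    (.inl ⟨_, _, rfl⟩)
  rw [realize_ofNumerals, leVars, realize_leFormula]
  refine ⟨numeralValue N (n - m), ?_⟩
  have h₁ : (addTerm (numeral (n - m)) (numeral m) : arith.Term (Empty ⊕ Fin 0)).realize
      (Sum.elim default default) = (numeral (n - m + m) : arith.Term (Empty ⊕ Fin 0)).realize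
        (Sum.elim default default : _ → N) := hN
  rw [realize_addTerm, realize_numeral, realize_numeral, realize_numeral,
    Nat.sub_add_cancel h] at h₁
  exact h₁

theorem theoryR_models_not_le {m n : ℕ} (h : n < m) : theoryR ⊨ᵇ ofNumerals leVars.not m n := by
  refine Theory.models_sentence_iff.2 fun N => ?_
  have hN := (Theory.model_iff (T := theoryR) (M := N)).1 inferInstance
  have hbound := hN (axBound n) (.inr (.inr (.inr (.inl ⟨n, rfl⟩))))
  rw [realize_ofNumerals, BoundedFormula.realize_not, leVars, realize_leFormula]
  rintro ⟨z, hz⟩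
  have h₁ := BoundedFormula.realize_all.1 hbound (numeralValue N m)
  rw [BoundedFormula.realize_imp, realize_leFormula, realize_disj] at h₁
  obtain ⟨φ, hφ, hφ'⟩ := h₁ ⟨z, hz.trans (realize_numeral _ n).symm⟩
  obtain ⟨i, hi, rfl⟩ := List.mem_map.1 hφ
  rw [List.mem_range] at hi
  have h₂ : numeralValue N m = numeralValue N i :=
    (BoundedFormula.realize_bdEqual _ _).1 hφ' |>.trans (realize_numeral _ i)
  have h₃ : ¬ ((numeral m : arith.Term (Empty ⊕ Fin 0)).realize (Sum.elim default default : _ → N) =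
      (numeral i : arith.Term (Empty ⊕ Fin 0)).realize (Sum.elim default default)) :=
    hN (axNe m i) (.inr (.inr (.inl ⟨m, i, by omega, rfl⟩)))
  rw [realize_numeral, realize_numeral] at h₃
  exact h₃ h₂

/-! ### No formula orders an infinite sequence of blocks -/

open Filter

section Stability

/-- The quantifier ‘for almost all `i` and almost all `j`’ of a fixed nonprincipal ultrafilter. -/
def Often (P : ℕ → ℕ → Prop) : Prop :=
  ∀ᶠ i in (hyperfilter ℕ : Filter ℕ), ∀ᶠ j in (hyperfilter ℕ : Filter ℕ), P i j

theorem Often.mono {P Q : ℕ → ℕ → Prop} (h : Often P) (hPQ : ∀ i j, P i j → Q i j) : Often Q :=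
  Eventually.mono h fun i hi => hi.mono fun j => hPQ i j

theorem often_forall {ι : Type*} [Finite ι] {P : ι → ℕ → ℕ → Prop} (h : ∀ x, Often (P x)) :
    Often fun i j => ∀ x, P x i j := by
  unfold Often
  simp only [eventually_all]
  exact h

theorem often_not {P : ℕ → ℕ → Prop} : (Often fun i j => ¬ P i j) ↔ ¬ Often P := by
  simp only [Often, Ultrafilter.eventually_not]

theorem often_lt : Often fun i j => i < j :=
  .of_forall fun i => (hyperfilter_le_cofinite (α := ℕ))
    (Nat.cofinite_eq_atTop ▸ eventually_gt_atTop i)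

theorem Often.exists_lt {P : ℕ → ℕ → Prop} (h : Often P) : ∃ i j, i < j ∧ P i j := by
  have : Often fun i j => i < j ∧ P i j :=
    (Eventually.and often_lt h).mono fun i hi => hi.1.and hi.2
  obtain ⟨i, hi⟩ := Eventually.exists this
  obtain ⟨j, hj⟩ := hi.exists
  exact ⟨i, j, hj⟩

theorem often_iff_of_unary (Q : ℕ → Prop) : Often fun i j => Q i ↔ Q j := by
  by_cases h : ∀ᶠ i in (hyperfilter ℕ : Filter ℕ), Q i
  · exact h.mono fun i hi => h.mono fun j hj => iff_of_true hi hj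
  · rw [← Ultrafilter.eventually_not] at h
    exact h.mono fun i hi => h.mono fun j hj => iff_of_false hi hj

/-- An equivalence relation does not order the terms of two sequences: if almost all terms of `f`
are equivalent to almost all terms of `g`, then almost all of these terms lie in one class. -/
theorem often_iff_of_equivalence {X : Type*} {r : X → X → Prop} (hr : Equivalence r)
    (f g : ℕ → X) : Often fun i j => r (f i) (g j) ↔ r (f j) (g i) := by
  have key : ∀ f g : ℕ → X, (Often fun i j => r (f i) (g j)) → Often fun i j => r (f j) (g i) := by
    intro f g h
    obtain ⟨i₀, h₀⟩ := Eventually.exists h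
    have hf : ∀ᶠ i in (hyperfilter ℕ : Filter ℕ), r (f i) (f i₀) := Eventually.mono h fun i hi => by
      obtain ⟨j, hj, hj'⟩ := (hi.and h₀).exists
      exact hr.trans hj (hr.symm hj')
    exact h₀.mono fun i hi => hf.mono fun j hj => hr.trans hj hi
  have h : (Often fun i j => r (f i) (g j)) ↔ Often fun i j => r (f j) (g i) :=
    ⟨key f g, fun h' => (key g f (h'.mono fun i j => hr.symm)).mono fun i j => hr.symm⟩
  by_cases hP : Often fun i j => r (f i) (g j)
  · exact (Eventually.and hP (h.1 hP)).mono fun i hi => (hi.1.and hi.2).mono fun j hj =>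
      iff_of_true hj.1 hj.2
  · exact (Eventually.and (often_not.2 hP) (often_not.2 (mt h.2 hP))).mono fun i hi =>
      (hi.1.and hi.2).mono fun j hj => iff_of_false hj.1 hj.2

variable {M : Type*} {P d : ℕ} (p : Fin P → M) (a : ℕ → Fin d → M)

/-- The entries of the parameters and of two blocks of the sequence `a`. -/
def pairVal (i j : ℕ) : Fin P ⊕ (Empty ⊕ Fin 2) × Fin d → M :=
  Sum.elim p fun x => Sum.elim Empty.elim ![a i, a j] x.1 x.2

/-- Every entry of `pairVal p a i j` is given by a sequence of elements, evaluated at `i` or at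
`j`. -/
theorem exists_pairVal_eq (x : Fin P ⊕ (Empty ⊕ Fin 2) × Fin d) : ∃ f : ℕ → M,
    (∀ i j, pairVal p a i j x = f i) ∨ ∀ i j, pairVal p a i j x = f j := by
  rcases x with x | ⟨x | x, y⟩
  · exact ⟨fun _ => p x, .inl fun _ _ => rfl⟩
  · exact x.elim
  · refine ⟨fun i => a i y, ?_⟩
    fin_cases x
    · exact .inl fun _ _ => rfl
    · exact .inr fun _ _ => rfl

theorem often_pairVal_swap_iff {r : M → M → Prop} (hr : Equivalence r)
    (x y : Fin P ⊕ (Empty ⊕ Fin 2) × Fin d) :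
    Often fun i j => r (pairVal p a i j x) (pairVal p a i j y) ↔
      r (pairVal p a j i x) (pairVal p a j i y) := by
  obtain ⟨f, hf | hf⟩ := exists_pairVal_eq p a x <;>
    obtain ⟨g, hg | hg⟩ := exists_pairVal_eq p a y <;> simp only [hf, hg]
  · exact often_iff_of_unary fun i => r (f i) (g i)
  · exact often_iff_of_equivalence hr f g
  · exact (often_iff_of_equivalence hr f g).mono fun i j => Iff.symm
  · exact (often_iff_of_unary fun i => r (f i) (g i)).mono fun i j => Iff.symm

theorem often_pairVal_swap_iff_unary (Q : M → Prop) (x : Fin P ⊕ (Empty ⊕ Fin 2) × Fin d) :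
    Often fun i j => Q (pairVal p a i j x) ↔ Q (pairVal p a j i x) := by
  obtain ⟨f, hf | hf⟩ := exists_pairVal_eq p a x <;> simp only [hf]
  · exact often_iff_of_unary fun i => Q (f i)
  · exact (often_iff_of_unary fun i => Q (f i)).mono fun i j => Iff.symm

/-- In a model of Janiczak's theory, the two blocks can be exchanged in `pairVal p a i j` for almost
all `i` and `j`, as far as a given formula can tell. -/
theorem exists_lt_realize_swap_iff [eqvLang.Structure M] [M ⊨ theoryJ]
    (θ : eqvLang.Formula (Fin P ⊕ (Empty ⊕ Fin 2) × Fin d)) :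
    ∃ i j, i < j ∧ (θ.Realize (pairVal p a i j) ↔ θ.Realize (pairVal p a j i)) := by
  set q := Nat.card (Fin P ⊕ (Empty ⊕ Fin 2) × Fin d) + 0 + depth θ with hq
  have hM := model_theoryJ_iff.1 (inferInstance : M ⊨ theoryJ) q
  have h₁ := often_forall fun x => often_forall fun y =>
    often_pairVal_swap_iff p a (r := Eq) eq_equivalence x y
  have h₂ := often_forall fun x => often_forall fun y =>
    often_pairVal_swap_iff p a hM.equivalence x y
  have h₃ := often_forall fun x => often_forall fun k : Fin q =>
    often_pairVal_swap_iff_unary p a (fun y => (eqvClass y).encard = (k : ℕ)) x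
  have h : Often fun i j => Similar q (pairVal p a i j) (pairVal p a j i) :=
    (Eventually.and h₁ (Eventually.and h₂ h₃)).mono fun i hi =>
      (hi.1.and (hi.2.1.and hi.2.2)).mono fun j hj =>
        ⟨hj.1, hj.2.1, fun x k hk => hj.2.2 x ⟨k, hk⟩⟩
  obtain ⟨i, j, hij, hsim⟩ := h.exists_lt
  refine ⟨i, j, hij, Similar.realize_iff hM hM (fun _ _ => Iff.rfl) θ ⟨?_, ?_, ?_⟩ hq.ge⟩
  · rintro (x | x) (y | y)
    · exact hsim.eq x y
    all_goals first | exact x.elim0 | exact y.elim0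
  · rintro (x | x) (y | y)
    · exact hsim.eqv x y
    all_goals first | exact x.elim0 | exact y.elim0
  · rintro (x | x)
    · exact hsim.size x
    · exact x.elim0

end Stability

open Translation in
/-- A consistent theory that contains Janiczak's theory does not interpret R: the interpretation
would order the infinitely many numerals. -/
theorem not_interprets_theoryR {T : eqvLang.Theory} (hT : T.IsSatisfiable) (hJ : theoryJ ⊆ T) :
    ¬ Interprets T theoryR := by
  rintro ⟨τ, hparams, hτ⟩
  obtain ⟨M⟩ := hT
  have hMT := (Theory.model_iff (T := T) (M := M)).1 inferInstance
  have : M ⊨ theoryJ := (Theory.model_iff _).2 fun φ hφ => hMT φ (hJ hφ)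
  obtain ⟨p, hp⟩ := realize_paramsExist.1 (Theory.models_sentence_iff.1 hparams M)
  have hsat : ∀ φ : arith.Sentence, theoryR ⊨ᵇ φ → Sat p φ (Fin.elim0 : Fin 0 → Fin τ.dim → M) :=
    fun φ hφ => realize_sentence.1 (Theory.models_sentence_iff.1 (hτ φ hφ) M) p hp
  -- `IsNumeral n x` says that the block `x` is equal to the numeral of `n`, in the translation.
  let IsNumeral : ℕ → (Fin τ.dim → M) → Prop := fun n x =>
    Sat p (.equal (n := 1) (.var (.inr 0)) (numeral n)) ![x]
  have hnum : ∀ {k : ℕ} (i : Fin k) (n : ℕ) (xs : Fin k → Fin τ.dim → M),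
      Sat p (.equal (.var (.inr i)) (numeral n)) xs ↔ IsNumeral n (xs i) := by
    intro k i n xs
    simp only [IsNumeral, sat_equal, realize_valueIs_var]
    have h : ∀ {l : ℕ} (ys : Fin l → Fin τ.dim → M) (z : Fin τ.dim → M),
        (τ.valueIs (numeral n)).Realize
          (τ.blockVal p fun o => o.elim z (Sum.elim Empty.elim ys)) ↔
        (τ.valueIs (numeral n : arith.Term Empty)).Realize (τ.blockVal p fun _ => z) := by
      intro l ys z
      rw [← numeral_relabel (Empty.elim : Empty → Empty ⊕ Fin l), realize_valueIs_relabel]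
      refine iff_of_eq (congrArg _ (congrArg _ (funext fun o => ?_)))
      rcases o with _ | o
      · rfl
      · exact o.elim
    simp only [h]
    rfl
  have hex : ∀ n, ∃ x, InDom p x ∧ IsNumeral n x := fun n => by
    obtain ⟨x, hx, hx'⟩ := sat_ex.1 (hsat _ (theoryR_models_existsNumeral n))
    exact ⟨x, hx, (hnum 0 n _).1 hx'⟩
  choose a ha ha' using hex
  have hall : ∀ (φ : arith.BoundedFormula Empty 2) (m n : ℕ), theoryR ⊨ᵇ ofNumerals φ m n →
      Sat p φ ![a m, a n] := by
    intro φ m n h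
    have h₁ := sat_all.1 (sat_all.1 (hsat _ h) (a m) (ha m)) (a n) (ha n)
    have h₂ : (Fin.snoc (Fin.snoc (Fin.elim0 : Fin 0 → Fin τ.dim → M) (a m)) (a n) :
        Fin 2 → Fin τ.dim → M) = ![a m, a n] := by
      funext i
      fin_cases i <;> rfl
    rw [h₂, sat_imp, sat_imp, hnum, hnum] at h₁
    exact h₁ (ha' m) (ha' n)
  obtain ⟨i, j, hij, h⟩ := exists_lt_realize_swap_iff p a (τ.formula leVars)
  exact sat_not.1 (hall _ j i (theoryR_models_not_le hij))
    (h.1 (hall _ i j (theoryR_models_le hij.le)))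

end TuringPersistence

open TuringPersistence in
theorem mainTheorem7 :
    ∃ (b c t : Nat.Partrec.Code → Nat.Partrec.Code),
      Computable b ∧ Computable c ∧ Computable t ∧
      ∀ d : TuringDegree, d ≠ degree ∅ →
        ∀ e : Nat.Partrec.Code, degree (reSet e) = d →
          (IsRIPair (reSet (b e)) (reSet (c e)) ∧
            TuringLE (reSet (b e)) (reSet e) ∧
            TuringLE (reSet (c e)) (reSet e) ∧
            ∀ D : Set ℕ, IsRE D → Separates D (reSet (b e)) (reSet (c e)) →
              TuringLE (reSet e) D) ∧
          IsConsistentRE (theoryT (reSet (b e)) (reSet (c e))) ∧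
          provable (theoryT (reSet (b e)) (reSet (c e))) = reSet (t e) ∧
          IsRecInseparable (theoryT (reSet (b e)) (reSet (c e))) ∧
          IsTuringPersistent (theoryT (reSet (b e)) (reSet (c e))) ∧
          degree (provable (theoryT (reSet (b e)) (reSet (c e)))) = d ∧
          ¬ Interprets (theoryT (reSet (b e)) (reSet (c e))) theoryR := by
  obtain ⟨b, c, t, hb, hc, ht, h⟩ := exists_indices
  refine ⟨b, c, t, hb, hc, ht, ?_⟩
  rintro _ hd e rfl
  obtain ⟨hbe, hce, hte⟩ := h e
  rw [hbe, hce, hte]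
  exact ⟨⟨isRIPair_loSet_hiSet hd, loSet_turingLE, hiSet_turingLE,
      fun _ => turingLE_of_separates⟩,
    isConsistentRE_theoryT, rfl, isRecInseparable_theoryT hd, isTuringPersistent_theoryT hd,
    degree_eq_of_turingLE provable_turingLE reSet_turingLE_provable,
    not_interprets_theoryR (theoryT_isSatisfiable disjoint_loSet_hiSet)
      fun _ hφ => .inl (.inl hφ)⟩
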